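/- Let $p,q$ be positive integers and let $(\bar M,J,g)$ be a locally metallic Riemannian manifold of dimension $n+r$: $g$ is a Riemannian metric, $J$ is a smooth $(1,1)$-tensor field with $J^2=pJ+qI$ and $g(JX,Y)=g(X,JY)$, and $\bar\nabla J=0$, where $\bar\nabla$ is the Levi-Civita connection of $g$. Let $M$ be an $n$-dimensional isometrically immersed submanifold of $\bar M$, with induced metric again denoted by $g$, Levi-Civita connection $\nabla$ and normal bundle $TM^\perp$. Write $(\cdot)^T$ and $(\cdot)^\perp$ for the tangential and normal components, and put $TX=(JX)^T$, $NX=(JX)^\perp$ for $X$ tangent and $tU=(JU)^T$, $nU=(JU)^\perp$ for $U$ normal; $(\nabla_XT)Y=\nabla_X(TY)-T(\nabla_XY)$. Let $N_1,\dots,N_r$ be a (local) smooth orthonormal frame of $TM^\perp$, let $\nabla^\perp_XU=(\bar\nabla_XU)^\perp$ be the normal connection, $\lambda_{\alpha\beta}(X)=g(\nabla^\perp_XN_\alpha,N_\beta)$, $h_\alpha(X,Y)=g(\bar\nabla_XY,N_\alpha)$ the second fundamental tensors, so that $(\bar\nabla_XY)^\perp=\sum_\alpha h_\alpha(X,Y)N_\alpha$,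 and $A_{N_\alpha}$ the shape operators, defined by $g(A_{N_\alpha}X,Y)=h_\alpha(X,Y)$. Then, wherever the frame is defined: 1. for all smooth tangent vector fields $X,Y$ of $M$, (a) $(\nabla_XT)Y=\sum_{\alpha=1}^r g(NY,N_\alpha)A_{N_\alpha}X+\sum_{\alpha=1}^r h_\alpha(X,Y)\,tN_\alpha$, (b) $\sum_{\alpha=1}^r g(NY,N_\alpha)\nabla^\perp_XN_\alpha=N(\nabla_XY)+\sum_{\alpha=1}^r h_\alpha(X,Y)\,nN_\alpha-\sum_{\alpha=1}^r h_\alpha(X,TY)N_\alpha-\sum_{\alpha=1}^r X(g(NY,N_\alpha))N_\alpha$; 2. for every smooth tangent vector field $X$ and every smooth normal vector field $U$, (a) $\nabla_X(tU)=\sum_{\alpha=1}^r\big[g(nU,N_\alpha)A_{N_\alpha}X-g(U,N_\alpha)\,T(A_{N_\alpha}X)\big]+\sum_{\alpha=1}^r\Big[X(g(U,N_\alpha))+\sum_{\beta=1}^r g(U,N_\beta)\lambda_{\beta\alpha}(X)\Big]tN_\alpha$, (b) $\sum_{\alpha=1}^r g(nU,N_\alpha)\nabla^\perp_XN_\alpha=-\sum_{\alpha=1}^r\big[X(g(nU,N_\alpha))+h_\alpha(X,tU)\big]N_\alpha+\sum_{\alpha=1}^r\Big[X(g(U,N_\alpha))+\sum_{\beta=1}^r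 g(U,N_\beta)\lambda_{\beta\alpha}(X)\Big]nN_\alpha-\sum_{\alpha=1}^r g(U,N_\alpha)\,N(A_{N_\alpha}X)$. -/

import Mathlib

open Bundle Set
open scoped Manifold ContDiff Topology

noncomputable section

namespace MetallicSubmanifold

/-! ### Levi-Civita connections and metallic Riemannian structures -/

section Ambient

variable {E : Type*} [NormedAddCommGroup E] [NormedSpace ℝ E] [FiniteDimensional ℝ E]
  {H : Type*} [TopologicalSpace H] {I : ModelWithCorners ℝ E H}
  {M : Type*} [TopologicalSpace M] [ChartedSpace H M] [IsManifold I ∞ M]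
  [RiemannianBundle (fun x : M => TangentSpace I x)]

/-- `cov` is the Levi-Civita connection of the Riemannian manifold `M`: it is compatible with the
metric, `v (g(Y, Z)) = g(∇_v Y, Z) + g(Y, ∇_v Z)`, and torsion-free,
`∇_Y Z - ∇_Z Y = [Y, Z]`. Mathlib writes `(∇_v Y)(x)` as `cov Y x v`. -/
structure IsLeviCivita (cov : CovariantDerivative I E (fun x : M => TangentSpace I x)) : Prop where
  metric : ∀ (x : M) (Y Z : Π x : M, TangentSpace I x), MDiffAt (T% Y) x → MDiffAt (T% Z) x →
    ∀ v : TangentSpace I x, mvfderiv I (fun y => inner ℝ (Y y) (Z y)) x v =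
      inner ℝ (cov Y x v) (Z x) + inner ℝ (Y x) (cov Z x v)
  torsion_free : cov.torsion = 0

/-- `(J, g)` is a metallic Riemannian structure with parameters `p, q ∈ ℕ*`: the smooth
`(1,1)`-tensor field `J` satisfies `J² = p J + q Id` and `g(J u, v) = g(u, J v)`. -/
structure IsMetallicRiemannian (p q : ℕ)
    (J : Π x : M, TangentSpace I x →L[ℝ] TangentSpace I x) : Prop where
  p_pos : 0 < p
  q_pos : 0 < q
  smooth : ContMDiff I (I.prod 𝓘(ℝ, E →L[ℝ] E)) ∞
    (fun x => (⟨x, J x⟩ : TotalSpace (E →L[ℝ] E)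
      (fun x : M => TangentSpace I x →L[ℝ] TangentSpace I x)))
  sq : ∀ (x : M) (v : TangentSpace I x), J x (J x v) = (p : ℝ) • J x v + (q : ℝ) • v
  symm : ∀ (x : M) (u v : TangentSpace I x), inner ℝ (J x u) v = inner ℝ u (J x v)

/-- The covariant derivative `(∇_v S) Y = ∇_v (S Y) - S (∇_v Y)` at `x` of a field `S` of
endomorphisms of the tangent spaces. -/
def covEnd (cov : CovariantDerivative I E (fun x : M => TangentSpace I x))
    (S : Π x : M, TangentSpace I x → TangentSpace I x)
    (Y : Π x : M, TangentSpace I x) (x : M) (v : TangentSpace I x) : TangentSpace I x :=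
  cov (fun y => S y (Y y)) x v - S x (cov Y x v)

/-- The metallic Riemannian manifold `(M, J, g)` with Levi-Civita connection `cov` is locally
metallic: `∇ J = 0`. -/
structure IsLocallyMetallic (p q : ℕ) (J : Π x : M, TangentSpace I x →L[ℝ] TangentSpace I x)
    (cov : CovariantDerivative I E (fun x : M => TangentSpace I x)) : Prop where
  metallic : IsMetallicRiemannian p q J
  leviCivita : IsLeviCivita cov
  parallel : ∀ (x : M) (Y : Π x : M, TangentSpace I x), MDiffAt (T% Y) x →
    ∀ v : TangentSpace I x, covEnd cov (fun y => J y) Y x v = 0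

end Ambient

/-! ### Geometry of an isometric immersion `f : M → M'` -/

section Submanifold

variable {E : Type*} [NormedAddCommGroup E] [NormedSpace ℝ E] [FiniteDimensional ℝ E]
  {H : Type*} [TopologicalSpace H] {I : ModelWithCorners ℝ E H}
  {M : Type*} [TopologicalSpace M] [ChartedSpace H M] [IsManifold I ∞ M]
  [RiemannianBundle (fun x : M => TangentSpace I x)]
  {E' : Type*} [NormedAddCommGroup E'] [NormedSpace ℝ E'] [FiniteDimensional ℝ E']
  {H' : Type*} [TopologicalSpace H'] {I' : ModelWithCorners ℝ E' H'}
  {M' : Type*} [TopologicalSpace M'] [ChartedSpace H' M'] [IsManifold I' ∞ M']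
  [RiemannianBundle (fun x : M' => TangentSpace I' x)]

variable (I I') in
/-- `f` is an isometric immersion: it is smooth and its differential preserves the metrics
(hence is injective). -/
structure IsIsometricImmersion (f : M → M') : Prop where
  smooth : ContMDiff I I' ∞ f
  isometric : ∀ (x : M) (u v : TangentSpace I x),
    inner ℝ (mfderiv I I' f x u) (mfderiv I I' f x v) = inner ℝ u v

/-- Smoothness on `O` of a vector field `W` along `f`, i.e. of a section `x ↦ W x ∈ T_{f x} M'` of
the pullback of `TM'`. -/
def SmoothAlongOn (I : ModelWithCorners ℝ E H) (f : M → M') (O : Set M)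
    (W : Π x : M, TangentSpace I' (f x)) : Prop :=
  ContMDiffOn I I'.tangent ∞ (fun x => (⟨f x, W x⟩ : TangentBundle I' M')) O

variable (I) in
/-- `w ∈ T_{f x} M'` is normal to the submanifold at `x`. -/
def IsNormalAt (f : M → M') (x : M) (w : TangentSpace I' (f x)) : Prop :=
  ∀ v : TangentSpace I x, inner ℝ w (mfderiv I I' f x v) = 0

variable (I) in
/-- `(ν_α)` is a smooth orthonormal family of normal vector fields on `O`. -/
structure IsOrthonormalNormalFrameOn {r : ℕ} (f : M → M') (O : Set M)
    (ν : Fin r → Π x : M, TangentSpace I' (f x)) : Prop where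
  smooth : ∀ α, SmoothAlongOn I f O (ν α)
  normal : ∀ α, ∀ x ∈ O, IsNormalAt I f x (ν α x)
  orthonormal : ∀ x ∈ O, Orthonormal ℝ (fun α => ν α x)

variable (I) in
/-- The tangent space of the submanifold at `x`, as a subspace of `T_{f x} M'`. -/
def tangentSubspace (f : M → M') (x : M) : Submodule ℝ (TangentSpace I' (f x)) :=
  LinearMap.range (mfderiv I I' f x).toLinearMap

instance (f : M → M') (x : M) : (tangentSubspace I (I' := I') f x).HasOrthogonalProjection :=
  haveI : FiniteDimensional ℝ (TangentSpace I x) := inferInstanceAs (FiniteDimensional ℝ E)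
  haveI : FiniteDimensional ℝ (tangentSubspace I (I' := I') f x) :=
    inferInstanceAs (FiniteDimensional ℝ (LinearMap.range (mfderiv I I' f x).toLinearMap))
  inferInstance

variable (I) in
/-- The tangential part `w^T` of `w ∈ T_{f x} M'`, seen in `T_x M`: the vector which `df_x` maps
to the orthogonal projection of `w` onto the tangent space of the submanifold. -/
def tan (f : M → M') (x : M) (w : TangentSpace I' (f x)) : TangentSpace I x :=
  Function.invFun (mfderiv I I' f x) ((tangentSubspace I f x).starProjection w)

variable (I) in
/-- The normal part `w^⊥` of `w ∈ T_{f x} M'`. -/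
def nor (f : M → M') (x : M) (w : TangentSpace I' (f x)) : TangentSpace I' (f x) :=
  w - (tangentSubspace I f x).starProjection w

/-- The tangent vector field `Y` of `M` as a vector field along `f`. -/
def push (f : M → M') (Y : Π x : M, TangentSpace I x) (x : M) : TangentSpace I' (f x) :=
  mfderiv I I' f x (Y x)

variable (f : M → M') (J : Π x : M', TangentSpace I' x →L[ℝ] TangentSpace I' x)

/-- `T v = (J v)^T` for `v` tangent. -/
def opT (x : M) (v : TangentSpace I x) : TangentSpace I x :=
  tan I f x (J (f x) (mfderiv I I' f x v))

/-- `N v = (J v)^⊥` for `v` tangent. -/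
def opN (x : M) (v : TangentSpace I x) : TangentSpace I' (f x) :=
  nor I f x (J (f x) (mfderiv I I' f x v))

variable (I) in
/-- `t w = (J w)^T` for `w` normal. -/
def opt (x : M) (w : TangentSpace I' (f x)) : TangentSpace I x :=
  tan I f x (J (f x) w)

variable (I) in
/-- `n w = (J w)^⊥` for `w` normal. -/
def opn (x : M) (w : TangentSpace I' (f x)) : TangentSpace I' (f x) :=
  nor I f x (J (f x) w)

variable (cov' : CovariantDerivative I' E' (fun x : M' => TangentSpace I' x))

/-- The derivative `∇̄_v W` at `x`, for `v ∈ T_x M`, of a vector field `W` along `f` with respect to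
a connection `∇̄` of `M'` (the pullback connection). If `(e_i)` is the frame of `TM'` given by the
trivialization at `f x` and `W = ∑ w_i (e_i ∘ f)`, it is
`∑ v(w_i) e_i(f x) + ∑ w_i(x) ∇̄_{df v} e_i`; the second sum is the derivative of the local field
with the constant coefficients `w_i(x)`, which is `FiberBundle.extend E' (W x)`. -/
def covAlong (W : Π x : M, TangentSpace I' (f x)) (x : M) (v : TangentSpace I x) :
    TangentSpace I' (f x) :=
  (trivializationAt E' (TangentSpace I' : M' → Type _) (f x)).symm (f x)
      (mvfderiv I (fun y => (trivializationAt E' (TangentSpace I' : M' → Type _) (f x)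
        (⟨f y, W y⟩ : TangentBundle I' M')).2) x v)
    + cov' (FiberBundle.extend E' (W x)) (f x) (mfderiv I I' f x v)

/-- The second fundamental form `h(v, Y) = (∇̄_v Y)^⊥` at `x`. -/
def secondFundamentalForm (x : M) (v : TangentSpace I x) (Y : Π x : M, TangentSpace I x) :
    TangentSpace I' (f x) :=
  nor I f x (covAlong f cov' (push f Y) x v)

/-- The second fundamental tensor `h_ξ(v, Y) = g(h(v, Y), ξ)` at `x` in the direction of the
normal field `ξ`. For an orthonormal normal frame, `h = ∑ h_{ν_α} ν_α`. -/
def hTensor (ξ : Π x : M, TangentSpace I' (f x)) (x : M) (v : TangentSpace I x)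
    (Y : Π x : M, TangentSpace I x) : ℝ :=
  inner ℝ (secondFundamentalForm f cov' x v Y) (ξ x)

open Classical in
/-- The shape operator: `A_ξ v ∈ T_x M` is the vector such that `g(A_ξ v, Y) = h_ξ(v, Y)` for all
vector fields `Y`. -/
def shapeOperator (ξ : Π x : M, TangentSpace I' (f x)) (x : M) (v : TangentSpace I x) :
    TangentSpace I x :=
  if h : ∃ a : TangentSpace I x, ∀ Y : Π x : M, TangentSpace I x, MDiffAt (T% Y) x →
      inner ℝ a (Y x) = hTensor f cov' ξ x v Y
  then h.choose else 0

/-- The normal connection `∇^⊥_v W = (∇̄_v W)^⊥` at `x`. -/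
def normalCov (W : Π x : M, TangentSpace I' (f x)) (x : M) (v : TangentSpace I x) :
    TangentSpace I' (f x) :=
  nor I f x (covAlong f cov' W x v)

/-- The connection forms `λ_{αβ}(v) = g(∇^⊥_v ν_α, ν_β)` at `x` of the normal connection. -/
def normalForm {r : ℕ} (ν : Fin r → Π x : M, TangentSpace I' (f x)) (α β : Fin r) (x : M)
    (v : TangentSpace I x) : ℝ :=
  inner ℝ (normalCov f cov' (ν α) x v) (ν β x)

end Submanifold

end MetallicSubmanifold

end

set_option linter.unusedSectionVars false

/-! Because `∇̄J = 0`, the endomorphism `J` commutes with differentiation along the immersion: `J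
(∇̄_v W) = ∇̄_v (J W)` for every differentiable field `W` along `f`. The four identities are the
tangential and normal parts of this equation for `W = df Y` and for `W = U`. On the left `∇̄_v W` is
expanded by the Gauss or the Weingarten formula. On the right `J W` is first split into its
tangential and normal fields, and each is differentiated by the same two formulas
(`tan_apply_covAlong`, `nor_apply_covAlong`). What remains is linear algebra.

The substance lies in justifying these formulas for `covAlong`, which is defined through one
trivialization at `f x`. It satisfies the Leibniz rule and, on restrictions `Z ∘ f`, the chain rule
`covAlong_comp`. Since every field along `f` is locally a combination of such restrictions,
parallelism of `J` and metric compatibility pass from `M'` to fields along `f` by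
`MDiffAlongAt.induction`. Torsion-freeness concerns `df` itself; in charts it is the symmetry of
second derivatives (`covAlong_push_extend_comm`). The Gauss formula `tan_covAlong_push` then follows
from uniqueness of the Levi-Civita connection, and the Weingarten formula from differentiating `g(ξ,
df Y) = 0`. Differentiability of tangential parts is obtained from inner products by Cramer's rule
(`mdifferentiableAt_of_inner`). -/

namespace MetallicSubmanifold

/-! ### Differentiable vector fields along a map and their derivatives. -/

section Along

variable {E : Type*} [NormedAddCommGroup E] [NormedSpace ℝ E] [FiniteDimensional ℝ E]
  {H : Type*} [TopologicalSpace H] {I : ModelWithCorners ℝ E H}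
  {M : Type*} [TopologicalSpace M] [ChartedSpace H M] [IsManifold I ∞ M]
  {E' : Type*} [NormedAddCommGroup E'] [NormedSpace ℝ E'] [FiniteDimensional ℝ E']
  {H' : Type*} [TopologicalSpace H'] {I' : ModelWithCorners ℝ E' H'}
  {M' : Type*} [TopologicalSpace M'] [ChartedSpace H' M'] [IsManifold I' ∞ M']

/-- Differentiability at `x` of a vector field along `f`. -/
noncomputable def MDiffAlongAt (I : ModelWithCorners ℝ E H) (f : M → M')
    (W : Π x : M, TangentSpace I' (f x)) (x : M) : Prop :=
  MDifferentiableAt I I'.tangent (fun y => (⟨f y, W y⟩ : TangentBundle I' M')) x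

/-- The coordinates of a vector field along `f` in the trivialization of `TM'` at `f x`. -/
noncomputable def coordAlong (f : M → M') (W : Π x : M, TangentSpace I' (f x)) (x y : M) : E' :=
  (trivializationAt E' (TangentSpace I' : M' → Type _) (f x) (⟨f y, W y⟩ : TangentBundle I' M')).2

variable {f : M → M'} {W W₁ W₂ : Π x : M, TangentSpace I' (f x)} {x : M}

lemma mdiffAlongAt_iff : MDiffAlongAt I f W x ↔
    MDifferentiableAt I I' f x ∧ MDifferentiableAt I 𝓘(ℝ, E') (coordAlong f W x) x :=
  mdifferentiableAt_totalSpace I' _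

lemma MDiffAlongAt.coord (h : MDiffAlongAt I f W x) :
    MDifferentiableAt I 𝓘(ℝ, E') (coordAlong f W x) x := (mdiffAlongAt_iff.1 h).2

lemma eventually_mem_baseSet (hf : MDifferentiableAt I I' f x) :
    ∀ᶠ y in 𝓝 x, f y ∈ (trivializationAt E' (TangentSpace I' : M' → Type _) (f x)).baseSet :=
  hf.continuousAt.eventually ((trivializationAt E' (TangentSpace I' : M' → Type _)
    (f x)).open_baseSet.mem_nhds (FiberBundle.mem_baseSet_trivializationAt' (f x)))

lemma coordAlong_add {y : M}
    (hy : f y ∈ (trivializationAt E' (TangentSpace I' : M' → Type _) (f x)).baseSet) :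
    coordAlong f (W₁ + W₂) x y = coordAlong f W₁ x y + coordAlong f W₂ x y :=
  ((trivializationAt E' (TangentSpace I' : M' → Type _) (f x)).linear ℝ hy).map_add _ _

lemma coordAlong_smul {y : M} (c : M → ℝ)
    (hy : f y ∈ (trivializationAt E' (TangentSpace I' : M' → Type _) (f x)).baseSet) :
    coordAlong f (fun z => c z • W z) x y = c y • coordAlong f W x y :=
  ((trivializationAt E' (TangentSpace I' : M' → Type _) (f x)).linear ℝ hy).map_smul _ _

lemma MDiffAlongAt.add (h₁ : MDiffAlongAt I f W₁ x) (h₂ : MDiffAlongAt I f W₂ x) :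
    MDiffAlongAt I f (W₁ + W₂) x := by
  have hf := (mdiffAlongAt_iff.1 h₁).1
  refine mdiffAlongAt_iff.2 ⟨hf, (h₁.coord.add h₂.coord).congr_of_eventuallyEq ?_⟩
  filter_upwards [eventually_mem_baseSet hf] with y hy using coordAlong_add hy

lemma MDiffAlongAt.smul {c : M → ℝ} (hc : MDifferentiableAt I 𝓘(ℝ, ℝ) c x)
    (h : MDiffAlongAt I f W x) : MDiffAlongAt I f (fun y => c y • W y) x := by
  have hf := (mdiffAlongAt_iff.1 h).1
  refine mdiffAlongAt_iff.2 ⟨hf, (hc.smul h.coord).congr_of_eventuallyEq ?_⟩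
  filter_upwards [eventually_mem_baseSet hf] with y hy using coordAlong_smul c hy

lemma mdiffAlongAt_zero (hf : MDifferentiableAt I I' f x) :
    MDiffAlongAt I f (fun y => (0 : TangentSpace I' (f y))) x := by
  refine mdiffAlongAt_iff.2 ⟨hf, (mdifferentiableAt_const (c := (0 : E'))).congr_of_eventuallyEq ?_⟩
  filter_upwards [eventually_mem_baseSet hf] with y hy using
    ((trivializationAt E' (TangentSpace I' : M' → Type _) (f x)).linear ℝ hy).map_zero

lemma MDiffAlongAt.sum {ι : Type*} (s : Finset ι) {V : ι → Π x : M, TangentSpace I' (f x)}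
    (hf : MDifferentiableAt I I' f x) (h : ∀ i ∈ s, MDiffAlongAt I f (V i) x) :
    MDiffAlongAt I f (fun y => ∑ i ∈ s, V i y) x := by
  classical
  induction s using Finset.induction_on with
  | empty => simpa using mdiffAlongAt_zero hf
  | insert i s hi ih =>
    simp only [Finset.sum_insert hi]
    exact (h i (by simp)).add (ih fun j hj => h j (by simp [hj]))

lemma MDiffAlongAt.sub (h₁ : MDiffAlongAt I f W₁ x) (h₂ : MDiffAlongAt I f W₂ x) :
    MDiffAlongAt I f (fun y => W₁ y - W₂ y) x := by
  have := h₁.add (h₂.smul (mdifferentiableAt_const (c := (-1 : ℝ))))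
  convert this using 1
  ext y
  simp [sub_eq_add_neg]

lemma MDiffAlongAt.congr (h : MDiffAlongAt I f W₁ x) (h' : ∀ᶠ y in 𝓝 x, W₂ y = W₁ y) :
    MDiffAlongAt I f W₂ x :=
  MDifferentiableAt.congr_of_eventuallyEq h (by filter_upwards [h'] with y hy; rw [hy])

lemma MDiffAlongAt.comp {Z : Π z : M', TangentSpace I' z} (hZ : MDiffAt (T% Z) (f x))
    (hf : MDifferentiableAt I I' f x) : MDiffAlongAt I f (fun y => Z (f y)) x :=
  MDifferentiableAt.comp x hZ hf

/-! ### The pullback connection -/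

variable (cov' : CovariantDerivative I' E' (fun x : M' => TangentSpace I' x))

lemma cov_congr {Z₁ Z₂ : Π z : M', TangentSpace I' z} {z : M'} (h₁ : MDiffAt (T% Z₁) z)
    (h : ∀ᶠ y in 𝓝 z, Z₁ y = Z₂ y) : cov' Z₁ z = cov' Z₂ z :=
  cov'.isCovariantDerivativeOn.congr_of_eventuallyEq h₁
    (h₁.congr_of_eventuallyEq (by filter_upwards [h] with y hy; simp [hy])) Filter.univ_mem h

/-- Exhibits the extension as a linear function of the extended vector, on the base set of the
trivialization. -/
lemma extend_eq_symmₗ {z₀ z : M'} (a : TangentSpace I' z₀)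
    (hz : z ∈ (trivializationAt E' (TangentSpace I' : M' → Type _) z₀).baseSet) :
    FiberBundle.extend E' a z = (trivializationAt E' (TangentSpace I' : M' → Type _) z₀).symmₗ ℝ z
      ((trivializationAt E' (TangentSpace I' : M' → Type _) z₀).linearMapAt ℝ z₀ a) := by
  rw [Trivialization.symmₗ_apply _ hz, Trivialization.coe_linearMapAt_of_mem _
    (FiberBundle.mem_baseSet_trivializationAt' z₀)]
  rfl

lemma eventually_mem_baseSet_self (z₀ : M') :
    ∀ᶠ z in 𝓝 z₀, z ∈ (trivializationAt E' (TangentSpace I' : M' → Type _) z₀).baseSet :=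
  (trivializationAt E' (TangentSpace I' : M' → Type _) z₀).open_baseSet.mem_nhds
    (FiberBundle.mem_baseSet_trivializationAt' z₀)

/-- Additivity of the connection term of `covAlong`: the extension is additive near `z`, and a
connection is local. -/
lemma cov_extend_add {z : M'} (a b : TangentSpace I' z) :
    cov' (FiberBundle.extend E' (a + b)) z =
      cov' (FiberBundle.extend E' a) z + cov' (FiberBundle.extend E' b) z := by
  rw [← cov'.isCovariantDerivativeOn.add (FiberBundle.mdifferentiableAt_extend I' E' _)
      (FiberBundle.mdifferentiableAt_extend I' E' _)]
  refine cov_congr cov' (FiberBundle.mdifferentiableAt_extend I' E' _) ?_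
  filter_upwards [eventually_mem_baseSet_self (I' := I') z] with y hy
  rw [Pi.add_apply, extend_eq_symmₗ _ hy, extend_eq_symmₗ _ hy, extend_eq_symmₗ _ hy, map_add,
    map_add]

lemma cov_extend_smul {z : M'} (c : ℝ) (a : TangentSpace I' z) :
    cov' (FiberBundle.extend E' (c • a)) z = c • cov' (FiberBundle.extend E' a) z := by
  rw [← cov'.isCovariantDerivativeOn.smul_const _ (FiberBundle.mdifferentiableAt_extend I' E' _)]
  refine cov_congr cov' (FiberBundle.mdifferentiableAt_extend I' E' _) ?_
  filter_upwards [eventually_mem_baseSet_self (I' := I') z] with y hy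
  rw [Pi.smul_apply, extend_eq_symmₗ _ hy, extend_eq_symmₗ _ hy, map_smul, map_smul]

lemma covAlong_eq (v : TangentSpace I x) : covAlong f cov' W x v =
    (trivializationAt E' (TangentSpace I' : M' → Type _) (f x)).symmₗ ℝ (f x)
      (mvfderiv I (coordAlong f W x) x v)
    + cov' (FiberBundle.extend E' (W x)) (f x) (mfderiv I I' f x v) := by
  rw [Trivialization.symmₗ_apply _ (FiberBundle.mem_baseSet_trivializationAt' (f x))]
  rfl

lemma mvfderiv_congr {F : Type*} [NormedAddCommGroup F] [NormedSpace ℝ F] {g₁ g₂ : M → F}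
    (h : g₁ =ᶠ[𝓝 x] g₂) (v : TangentSpace I x) : mvfderiv I g₁ x v = mvfderiv I g₂ x v := by
  have := h.mfderiv_eq (I := I) (I' := 𝓘(ℝ, F))
  exact congrArg (fun L : E →L[ℝ] F => L v) this

lemma covAlong_congr (h : ∀ᶠ y in 𝓝 x, W₁ y = W₂ y) (v : TangentSpace I x) :
    covAlong f cov' W₁ x v = covAlong f cov' W₂ x v := by
  rw [covAlong_eq, covAlong_eq, h.self_of_nhds, mvfderiv_congr (g₂ := coordAlong f W₂ x)]
  filter_upwards [h] with y hy
  simp [coordAlong, hy]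

lemma covAlong_add (h₁ : MDiffAlongAt I f W₁ x) (h₂ : MDiffAlongAt I f W₂ x)
    (v : TangentSpace I x) :
    covAlong f cov' (W₁ + W₂) x v = covAlong f cov' W₁ x v + covAlong f cov' W₂ x v := by
  have hf := (mdiffAlongAt_iff.1 h₁).1
  rw [covAlong_eq, covAlong_eq, covAlong_eq,
    mvfderiv_congr (g₂ := coordAlong f W₁ x + coordAlong f W₂ x)
      (by filter_upwards [eventually_mem_baseSet hf] with y hy using coordAlong_add hy),
    mvfderiv_add h₁.coord h₂.coord, Pi.add_apply, cov_extend_add, add_apply, add_apply, map_add]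
  abel

lemma symm_coordAlong_self :
    (trivializationAt E' (TangentSpace I' : M' → Type _) (f x)).symmₗ ℝ (f x) (coordAlong f W x x)
      = W x := by
  rw [Trivialization.symmₗ_apply _ (FiberBundle.mem_baseSet_trivializationAt' (f x))]
  exact (trivializationAt E' (TangentSpace I' : M' → Type _) (f x)).symm_apply_apply_mk
    (FiberBundle.mem_baseSet_trivializationAt' (f x)) (W x)

/-- The derivative of `c` arises only from the coordinate term; the connection term sees just the
number `c x`. -/
lemma covAlong_smul {c : M → ℝ} (hc : MDifferentiableAt I 𝓘(ℝ, ℝ) c x)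
    (h : MDiffAlongAt I f W x) (v : TangentSpace I x) :
    covAlong f cov' (fun y => c y • W y) x v =
      mvfderiv I c x v • W x + c x • covAlong f cov' W x v := by
  have hf := (mdiffAlongAt_iff.1 h).1
  rw [covAlong_eq, covAlong_eq,
    mvfderiv_congr (g₂ := c • coordAlong f W x)
      (by filter_upwards [eventually_mem_baseSet hf] with y hy using coordAlong_smul c hy),
    mvfderiv_smul hc h.coord, cov_extend_smul]
  simp only [add_apply, smul_apply, map_add, map_smul,
    ContinuousLinearMap.smulRight_apply, symm_coordAlong_self, smul_add]
  abel

lemma covAlong_zero (hf : MDifferentiableAt I I' f x) (v : TangentSpace I x) :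
    covAlong f cov' (fun y => (0 : TangentSpace I' (f y))) x v = 0 := by
  have h := covAlong_smul cov' (mdifferentiableAt_const (c := (0 : ℝ))) (mdiffAlongAt_zero hf) v
  simpa [mvfderiv_const] using h

lemma covAlong_sum {ι : Type*} (s : Finset ι) {V : ι → Π x : M, TangentSpace I' (f x)}
    (hf : MDifferentiableAt I I' f x) (h : ∀ i ∈ s, MDiffAlongAt I f (V i) x)
    (v : TangentSpace I x) :
    covAlong f cov' (fun y => ∑ i ∈ s, V i y) x v = ∑ i ∈ s, covAlong f cov' (V i) x v := by
  classical
  induction s using Finset.induction_on with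
  | empty => simpa using covAlong_zero cov' hf v
  | insert i s hi ih =>
    simp only [Finset.sum_insert hi]
    rw [← ih fun j hj => h j (by simp [hj])]
    exact covAlong_add cov' (h i (by simp)) (.sum s hf fun j hj => h j (by simp [hj])) v

/-- The extension has constant coordinates in the trivialization at `f x`, so the coordinate term
vanishes. -/
lemma covAlong_extend_comp (hf : MDifferentiableAt I I' f x) (a : TangentSpace I' (f x))
    (v : TangentSpace I x) :
    covAlong f cov' (fun y => FiberBundle.extend E' a (f y)) x v =
      cov' (FiberBundle.extend E' a) (f x) (mfderiv I I' f x v) := by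
  let e := trivializationAt E' (TangentSpace I' : M' → Type _) (f x)
  rw [covAlong_eq, mvfderiv_congr (g₂ := fun _ => (e ⟨f x, a⟩).2), mvfderiv_const]
  · simp
  · filter_upwards [eventually_mem_baseSet hf] with y hy
    have := congrArg Prod.snd (e.apply_mk_symm hy (e ⟨f x, a⟩).2)
    exact this

/-- A vector field along `f` is near `x` a combination of vector fields of `M'`. -/
lemma exists_eventually_eq_sum (h : MDiffAlongAt I f W x) :
    ∃ (c : Fin (Module.finrank ℝ E') → M → ℝ)
      (a : Fin (Module.finrank ℝ E') → TangentSpace I' (f x)),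
      (∀ i, MDifferentiableAt I 𝓘(ℝ, ℝ) (c i) x) ∧
      ∀ᶠ y in 𝓝 x, W y = ∑ i, c i y • FiberBundle.extend E' (a i) (f y) := by
  let e := trivializationAt E' (TangentSpace I' : M' → Type _) (f x)
  have he : f x ∈ e.baseSet := FiberBundle.mem_baseSet_trivializationAt' (f x)
  let b := Module.finBasis ℝ E'
  -- The coefficients are the coordinates of `W` in a basis of `E'`; the vectors are the values at
  -- `f x` of the matching frame of `TM'`.
  refine ⟨fun i y => b.equivFunL (coordAlong f W x y) i, fun i => e.symm (f x) (b i), ?_, ?_⟩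
  · intro i
    have h1 := h.coord
    let L : E' →L[ℝ] ℝ := (ContinuousLinearMap.proj i).comp b.equivFunL.toContinuousLinearMap
    exact (L.mdifferentiableAt (x := coordAlong f W x x)).comp x h1
  · filter_upwards [eventually_mem_baseSet (mdiffAlongAt_iff.1 h).1] with y hy
    have h1 : ∀ i, FiberBundle.extend E' (e.symm (f x) (b i) : TangentSpace I' (f x)) (f y)
        = e.symmₗ ℝ (f y) (b i) := by
      intro i
      have h2 := congrArg Prod.snd (e.apply_mk_symm he (b i))
      rw [Trivialization.symmₗ_apply _ hy]
      exact congrArg (e.symm (f y)) h2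
    simp only [h1, ← map_smul, ← map_sum]
    have h2 : ∑ i, b.equivFunL (coordAlong f W x y) i • b i = coordAlong f W x y :=
      b.sum_equivFun _
    rw [h2, Trivialization.symmₗ_apply _ hy]
    exact (e.symm_apply_apply_mk hy (W y)).symm

lemma cov_sum_smul {ι : Type*} (s : Finset ι) {z : M'} {c : ι → M' → ℝ}
    {Z : ι → Π z : M', TangentSpace I' z}
    (hc : ∀ i ∈ s, MDifferentiableAt I' 𝓘(ℝ, ℝ) (c i) z)
    (hZ : ∀ i ∈ s, MDiffAt (T% (Z i)) z) (v : TangentSpace I' z) :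
    cov' (fun y => ∑ i ∈ s, c i y • Z i y) z v =
      ∑ i ∈ s, (mvfderiv I' (c i) z v • Z i z + c i z • cov' (Z i) z v) := by
  classical
  induction s using Finset.induction_on with
  | empty =>
    have := congrFun cov'.zero z
    simp only [Finset.sum_empty]
    exact congrArg (fun L => L v) this
  | insert i s hi ih =>
    have h1 : MDiffAt (T% (c i • Z i)) z := (hc i (by simp)).smul_section (hZ i (by simp))
    have h2 : MDiffAt (T% (fun y => ∑ i ∈ s, c i y • Z i y)) z :=
      MDifferentiableAt.sum_section (t := fun i y => c i y • Z i y)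
        fun j hj => (hc j (by simp [hj])).smul_section (hZ j (by simp [hj]))
    have h3 : (fun y => ∑ i ∈ insert i s, c i y • Z i y) =
        c i • Z i + fun y => ∑ i ∈ s, c i y • Z i y := by
      ext y
      simp [Finset.sum_insert hi]
    rw [h3, cov'.isCovariantDerivativeOn.add h1 h2, add_apply,
      ih (fun j hj => hc j (by simp [hj])) (fun j hj => hZ j (by simp [hj])),
      Finset.sum_insert hi,
      cov'.isCovariantDerivativeOn.leibniz (hZ i (by simp)) (hc i (by simp))]
    simp [add_comm]

lemma mvfderiv_comp_base {c : M' → ℝ} (hc : MDifferentiableAt I' 𝓘(ℝ, ℝ) c (f x))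
    (hf : MDifferentiableAt I I' f x) (v : TangentSpace I x) :
    mvfderiv I (fun y => c (f y)) x v = mvfderiv I' c (f x) (mfderiv I I' f x v) :=
  mvfderiv_comp_apply x hc hf v

/-- Both sides are local and obey the Leibniz rule, so it suffices to compare them on the frame
fields, where `covAlong_extend_comp` applies. -/
lemma covAlong_comp {Z : Π z : M', TangentSpace I' z} (hZ : MDiffAt (T% Z) (f x))
    (hf : MDifferentiableAt I I' f x) (v : TangentSpace I x) :
    covAlong f cov' (fun y => Z (f y)) x v = cov' Z (f x) (mfderiv I I' f x v) := by
  -- A vector field on `M'` is a field along the identity map.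
  obtain ⟨c, a, hc, hca⟩ := exists_eventually_eq_sum (I := I') (f := fun z : M' => z) (W := Z)
    (x := f x) hZ
  have hcf : ∀ i, MDifferentiableAt I 𝓘(ℝ, ℝ) (fun y => c i (f y)) x := fun i => (hc i).comp x hf
  have hE : ∀ i, MDiffAt (T% (FiberBundle.extend E' (a i) : Π z : M', TangentSpace I' z)) (f x) :=
    fun i => FiberBundle.mdifferentiableAt_extend I' E' _
  rw [covAlong_congr cov' (hf.continuousAt.eventually hca),
    covAlong_sum cov' _ hf fun i _ => (MDiffAlongAt.comp (hE i) hf).smul (hcf i),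
    cov_congr cov' hZ hca, cov_sum_smul cov' _ (fun i _ => hc i) fun i _ => hE i]
  refine Finset.sum_congr rfl fun i _ => ?_
  rw [covAlong_smul cov' (hcf i) (.comp (hE i) hf), covAlong_extend_comp cov' hf,
    mvfderiv_comp_base (hc i) hf]

/-- Induction on differentiable vector fields along `f`, starting from restrictions of vector fields
of `M'`. -/
lemma MDiffAlongAt.induction {P : (Π x : M, TangentSpace I' (f x)) → Prop}
    (congr : ∀ V₁ V₂, MDiffAlongAt I f V₁ x → (∀ᶠ y in 𝓝 x, V₂ y = V₁ y) → P V₁ → P V₂)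
    (zero : P fun y => (0 : TangentSpace I' (f y)))
    (add : ∀ V₁ V₂, MDiffAlongAt I f V₁ x → MDiffAlongAt I f V₂ x → P V₁ → P V₂ → P (V₁ + V₂))
    (smul : ∀ (c : M → ℝ) V, MDifferentiableAt I 𝓘(ℝ, ℝ) c x → MDiffAlongAt I f V x → P V →
      P fun y => c y • V y)
    (comp : ∀ Z : Π z : M', TangentSpace I' z, MDiffAt (T% Z) (f x) → P fun y => Z (f y))
    (h : MDiffAlongAt I f W x) : P W := by
  classical
  have hf := (mdiffAlongAt_iff.1 h).1
  obtain ⟨c, a, hc, hca⟩ := exists_eventually_eq_sum h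
  have hE : ∀ i, MDiffAt (T% (FiberBundle.extend E' (a i) : Π z : M', TangentSpace I' z)) (f x) :=
    fun i => FiberBundle.mdifferentiableAt_extend I' E' _
  have hcE : ∀ i, MDiffAlongAt I f (fun y => c i y • FiberBundle.extend E' (a i) (f y)) x :=
    fun i => (MDiffAlongAt.comp (hE i) hf).smul (hc i)
  refine congr _ _ (.sum Finset.univ hf fun i _ => hcE i) hca ?_
  generalize (Finset.univ : Finset (Fin (Module.finrank ℝ E'))) = s
  induction s using Finset.induction_on with
  | empty => simpa using zero
  | insert i s hi ih =>
    simp only [Finset.sum_insert hi]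
    exact add _ _ (hcE i) (.sum s hf fun j _ => hcE j)
      (smul _ _ (hc i) (.comp (hE i) hf) (comp _ (hE i))) ih

end Along

/-! ### Parallel endomorphisms and metric compatibility along a map. -/

section Metric

variable {E : Type*} [NormedAddCommGroup E] [NormedSpace ℝ E] [FiniteDimensional ℝ E]
  {H : Type*} [TopologicalSpace H] {I : ModelWithCorners ℝ E H}
  {M : Type*} [TopologicalSpace M] [ChartedSpace H M] [IsManifold I ∞ M]
  {E' : Type*} [NormedAddCommGroup E'] [NormedSpace ℝ E'] [FiniteDimensional ℝ E']
  {H' : Type*} [TopologicalSpace H'] {I' : ModelWithCorners ℝ E' H'}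
  {M' : Type*} [TopologicalSpace M'] [ChartedSpace H' M'] [IsManifold I' ∞ M']
  [RiemannianBundle (fun x : M' => TangentSpace I' x)]
  {f : M → M'} {W W₁ W₂ : Π x : M, TangentSpace I' (f x)} {x : M}
  {D' : CovariantDerivative I' E' (fun x : M' => TangentSpace I' x)}
  {J : Π x : M', TangentSpace I' x →L[ℝ] TangentSpace I' x} {p q : ℕ}

lemma MDiffAlongAt.apply_metallic (hJ : IsMetallicRiemannian p q J) (h : MDiffAlongAt I f W x) :
    MDiffAlongAt I f (fun y => J (f y) (W y)) x := by
  have hf := (mdiffAlongAt_iff.1 h).1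
  have h1 : MDifferentiableAt I (I'.prod 𝓘(ℝ, E' →L[ℝ] E'))
      (fun y => (⟨f y, J (f y)⟩ : TotalSpace (E' →L[ℝ] E')
        (fun x : M' => TangentSpace I' x →L[ℝ] TangentSpace I' x))) x :=
    MDifferentiableAt.comp x ((hJ.smooth.mdifferentiable (by simp)) (f x)) hf
  exact MDifferentiableAt.clm_bundle_apply (F₁ := E') (F₂ := E') h1 h

/-- A parallel endomorphism field commutes with the pullback connection. -/
lemma covAlong_apply_metallic (hJ : IsLocallyMetallic p q J D') (h : MDiffAlongAt I f W x)
    (v : TangentSpace I x) :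
    covAlong f D' (fun y => J (f y) (W y)) x v = J (f x) (covAlong f D' W x v) := by
  have hf := (mdiffAlongAt_iff.1 h).1
  refine h.induction (P := fun W => covAlong f D' (fun y => J (f y) (W y)) x v =
    J (f x) (covAlong f D' W x v)) ?_ ?_ ?_ ?_ ?_
  · intro V₁ V₂ h1 h12 hV
    rw [covAlong_congr D' h12, ← hV]
    refine covAlong_congr D' ?_ v
    filter_upwards [h12] with y hy
    rw [hy]
  · simp only [map_zero]
    rw [covAlong_zero D' hf, map_zero]
  · intro V₁ V₂ h1 h2 hV₁ hV₂
    rw [covAlong_add D' h1 h2, map_add, ← hV₁, ← hV₂,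
      ← covAlong_add D' (h1.apply_metallic hJ.metallic) (h2.apply_metallic hJ.metallic)]
    congr 1
    ext y
    simp
  · intro c V hc hV h1
    simp only [map_smul]
    rw [covAlong_smul D' hc (hV.apply_metallic hJ.metallic), covAlong_smul D' hc hV, h1,
      map_add, map_smul, map_smul]
  · intro Z hZ
    have h1 : MDiffAt (T% (fun z => J z (Z z))) (f x) :=
      MDiffAlongAt.apply_metallic (f := fun z : M' => z) (I := I') (W := Z) hJ.metallic hZ
    rw [covAlong_comp D' h1 hf, covAlong_comp D' hZ hf]
    exact sub_eq_zero.1 (hJ.parallel (f x) Z hZ _)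

variable [IsContMDiffRiemannianBundle I' ∞ E' (fun x : M' => TangentSpace I' x)]

lemma MDiffAlongAt.inner (h₁ : MDiffAlongAt I f W₁ x) (h₂ : MDiffAlongAt I f W₂ x) :
    MDifferentiableAt I 𝓘(ℝ, ℝ) (fun y => inner ℝ (W₁ y) (W₂ y)) x :=
  MDifferentiableAt.inner_bundle (IB := I') (F := E') (E := fun x : M' => TangentSpace I' x) h₁ h₂

/-- The pullback of a Levi-Civita connection is compatible with the metric. -/
lemma mvfderiv_inner_along (hD : IsLeviCivita D') (h₁ : MDiffAlongAt I f W₁ x)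
    (h₂ : MDiffAlongAt I f W₂ x) (v : TangentSpace I x) :
    mvfderiv I (fun y => inner ℝ (W₁ y) (W₂ y)) x v =
      inner ℝ (covAlong f D' W₁ x v) (W₂ x) + inner ℝ (W₁ x) (covAlong f D' W₂ x v) := by
  have hf := (mdiffAlongAt_iff.1 h₁).1
  refine h₁.induction (P := fun W₁ => mvfderiv I (fun y => inner ℝ (W₁ y) (W₂ y)) x v =
      inner ℝ (covAlong f D' W₁ x v) (W₂ x) + inner ℝ (W₁ x) (covAlong f D' W₂ x v)) ?_ ?_ ?_ ?_ ?_
  · intro V₁ V₂ h1 h12 hV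
    rw [covAlong_congr D' h12, h12.self_of_nhds, ← hV]
    refine mvfderiv_congr ?_ v
    filter_upwards [h12] with y hy
    rw [hy]
  · simp only [inner_zero_left, mvfderiv_const]
    rw [covAlong_zero D' hf]
    simp
  · intro V₁ V₂ hV₁ hV₂ h1 h2
    simp only [Pi.add_apply, inner_add_left]
    rw [mvfderiv_fun_add (hV₁.inner h₂) (hV₂.inner h₂), add_apply, h1, h2,
      covAlong_add D' hV₁ hV₂, inner_add_left]
    ring
  · intro c V hc hV h1
    simp only [real_inner_smul_left]
    rw [mvfderiv_fun_mul hc (hV.inner h₂), add_apply, smul_apply, smul_apply, h1,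
      covAlong_smul D' hc hV, inner_add_left, real_inner_smul_left, real_inner_smul_left]
    simp only [smul_eq_mul]
    ring
  -- The first field is now a restriction `Z ∘ f`; a second induction reduces the other one to a
  -- restriction as well.
  intro Z hZ
  have hZf := MDiffAlongAt.comp hZ hf
  refine h₂.induction (P := fun W₂ => mvfderiv I (fun y => inner ℝ (Z (f y)) (W₂ y)) x v =
      inner ℝ (covAlong f D' (fun y => Z (f y)) x v) (W₂ x) +
        inner ℝ (Z (f x)) (covAlong f D' W₂ x v)) ?_ ?_ ?_ ?_ ?_
  · intro V₁ V₂ h1 h12 hV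
    rw [covAlong_congr D' h12, h12.self_of_nhds, ← hV]
    refine mvfderiv_congr ?_ v
    filter_upwards [h12] with y hy
    rw [hy]
  · simp only [inner_zero_right, mvfderiv_const]
    rw [covAlong_zero D' hf]
    simp
  · intro V₁ V₂ hV₁ hV₂ h1 h2
    simp only [Pi.add_apply, inner_add_right]
    rw [mvfderiv_fun_add (hZf.inner hV₁) (hZf.inner hV₂), add_apply, h1, h2,
      covAlong_add D' hV₁ hV₂, inner_add_right]
    ring
  · intro c V hc hV h1
    simp only [real_inner_smul_right]
    rw [mvfderiv_fun_mul hc (hZf.inner hV), add_apply, smul_apply, smul_apply, h1,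
      covAlong_smul D' hc hV, inner_add_right, real_inner_smul_right, real_inner_smul_right]
    simp only [smul_eq_mul]
    ring
  · intro Z₂ hZ₂
    have h1 : MDifferentiableAt I' 𝓘(ℝ, ℝ) (fun z => inner ℝ (Z z) (Z₂ z)) (f x) :=
      MDiffAlongAt.inner (I := I') (f := fun z : M' => z) hZ hZ₂
    rw [mvfderiv_comp_base (c := fun z => inner ℝ (Z z) (Z₂ z)) h1 hf, covAlong_comp D' hZ hf,
      covAlong_comp D' hZ₂ hf, hD.metric (f x) Z Z₂ hZ hZ₂]

end Metric

/-! ### Torsion-freeness of the pullback connection. -/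

section Symmetry

variable {E : Type*} [NormedAddCommGroup E] [NormedSpace ℝ E] [FiniteDimensional ℝ E]
  {H : Type*} [TopologicalSpace H] {I : ModelWithCorners ℝ E H}
  {M : Type*} [TopologicalSpace M] [ChartedSpace H M] [IsManifold I ∞ M]
  {E' : Type*} [NormedAddCommGroup E'] [NormedSpace ℝ E'] [FiniteDimensional ℝ E']
  {H' : Type*} [TopologicalSpace H'] {I' : ModelWithCorners ℝ E' H'}
  {M' : Type*} [TopologicalSpace M'] [ChartedSpace H' M'] [IsManifold I' ∞ M']
  {f : M → M'} {x : M}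

/-- Near `x`, the extension of `w ∈ T_x M` is a constant field in the chart at `x`. -/
lemma extend_eq_mfderivWithin (w : TangentSpace I x) {y : M} (hy : y ∈ (chartAt H x).source) :
    FiberBundle.extend E w y =
      mfderivWithin 𝓘(ℝ, E) I (extChartAt I x).symm (range I) (extChartAt I x y)
        ((trivializationAt E (TangentSpace I : M → Type _) x).linearMapAt ℝ x w) := by
  have hy' : y ∈ (trivializationAt E (TangentSpace I : M → Type _) x).baseSet := by simpa using hy
  rw [extend_eq_symmₗ w hy', ← TangentBundle.symmL_trivializationAt hy]
  rfl

/-- The preferred chart at `x` has the identity as its derivative at `x`. -/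
lemma linearMapAt_self (w : TangentSpace I x) :
    (trivializationAt E (TangentSpace I : M → Type _) x).linearMapAt ℝ x w = w := by
  have h := TangentBundle.continuousLinearMapAt_trivializationAt (I := I) (mem_chart_source H x)
  rw [mfderiv_extChartAt_self] at h
  exact congrArg (fun L : E →L[ℝ] E => L w) h

/-- Read in the chart at `x`, both extensions are constant fields, and these commute. -/
lemma mlieBracket_extend (v w : TangentSpace I x) :
    VectorField.mlieBracket I (FiberBundle.extend E v) (FiberBundle.extend E w) x = 0 := by
  have key : ∀ w : TangentSpace I x, ∀ᶠ z in 𝓝[range I] (extChartAt I x x),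
      VectorField.mpullbackWithin 𝓘(ℝ, E) I (extChartAt I x).symm (FiberBundle.extend E w) (range I)
        z = (trivializationAt E (TangentSpace I : M → Type _) x).linearMapAt ℝ x w := by
    intro w
    filter_upwards [extChartAt_target_mem_nhdsWithin x] with z hz
    have hy : (extChartAt I x).symm z ∈ (chartAt H x).source := by
      simpa [extChartAt_source] using (extChartAt I x).map_target hz
    rw [VectorField.mpullbackWithin_apply, extend_eq_mfderivWithin w hy,
      (extChartAt I x).right_inv hz]
    exact (isInvertible_mfderivWithin_extChartAt_symm hz).inverse_apply_eq.2 rfl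
  rw [← VectorField.mlieBracketWithin_univ, VectorField.mlieBracketWithin_apply]
  have h0 : VectorField.lieBracketWithin ℝ
      (VectorField.mpullbackWithin 𝓘(ℝ, E) I (extChartAt I x).symm (FiberBundle.extend E v)
        (range I))
      (VectorField.mpullbackWithin 𝓘(ℝ, E) I (extChartAt I x).symm (FiberBundle.extend E w)
        (range I)) ((extChartAt I x).symm ⁻¹' univ ∩ range I) (extChartAt I x x) = 0 := by
    rw [preimage_univ, univ_inter]
    rw [Filter.EventuallyEq.lieBracketWithin_vectorField_eq
      (V := fun _ => (trivializationAt E (TangentSpace I : M → Type _) x).linearMapAt ℝ x v)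
      (W := fun _ => (trivializationAt E (TangentSpace I : M → Type _) x).linearMapAt ℝ x w)
      (key v) ((key v).self_of_nhdsWithin (mem_range_self _)) (key w)
      ((key w).self_of_nhdsWithin (mem_range_self _))]
    simp [VectorField.lieBracketWithin]
  rw [h0]
  exact ContinuousLinearMap.map_zero _

lemma cov_extend_comm {D : CovariantDerivative I E (fun x : M => TangentSpace I x)}
    (hD : D.torsion = 0) (v w : TangentSpace I x) :
    D (FiberBundle.extend E v) x w = D (FiberBundle.extend E w) x v := by
  have h := D.torsion_apply_eq_extend (x := x) w v
  rw [hD, mlieBracket_extend, FiberBundle.extend_apply_self, FiberBundle.extend_apply_self] at h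
  simp only [Pi.zero_apply, zero_apply, sub_zero] at h
  exact sub_eq_zero.1 h.symm

/-- The derivative of `f` read in charts at `x` and `f x`, in terms of the local expression. -/
lemma coordAlong_push_extend [I.Boundaryless] (hf : ContMDiff I I' ∞ f) (w : TangentSpace I x) :
    ∀ᶠ y in 𝓝 x, coordAlong (I' := I') f (push f (FiberBundle.extend E w)) x y =
      fderiv ℝ (writtenInExtChartAt I I' x f) (extChartAt I x y) w := by
  have hfx : MDifferentiable I I' f := hf.mdifferentiable (by simp)
  filter_upwards [eventually_mem_baseSet (hfx x), chart_source_mem_nhds H x] with y hy hyx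
  have hy' : f y ∈ (chartAt H' (f x)).source := by simpa using hy
  have hz : extChartAt I x y ∈ (extChartAt I x).target :=
    (extChartAt I x).map_source (by simpa [extChartAt_source] using hyx)
  have hzy : (extChartAt I x).symm (extChartAt I x y) = y :=
    (extChartAt I x).left_inv (by simpa [extChartAt_source] using hyx)
  have h1 : coordAlong (I' := I') f (push f (FiberBundle.extend E w)) x y =
      mfderiv I' 𝓘(ℝ, E') (extChartAt I' (f x)) (f y)
        (mfderiv I I' f y (FiberBundle.extend E w y)) := by
    rw [← TangentBundle.continuousLinearMapAt_trivializationAt hy']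
    exact (congrFun (Trivialization.coe_linearMapAt_of_mem (R := ℝ) _ hy) _).symm
  rw [h1, extend_eq_mfderivWithin w hyx, linearMapAt_self, I.range_eq_univ, mfderivWithin_univ]
  have hd1 : MDifferentiableAt 𝓘(ℝ, E) I (extChartAt I x).symm (extChartAt I x y) := by
    have := mdifferentiableWithinAt_extChartAt_symm (I := I) hz
    rwa [I.range_eq_univ, mdifferentiableWithinAt_univ] at this
  have hd3 : MDifferentiableAt I' 𝓘(ℝ, E') (extChartAt I' (f x)) (f y) :=
    mdifferentiableAt_extChartAt hy'
  have hd2 : MDifferentiableAt 𝓘(ℝ, E) I' (f ∘ (extChartAt I x).symm) (extChartAt I x y) :=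
    MDifferentiableAt.comp _ (hfx _) hd1
  -- Chain rule for chart ∘ `f` ∘ inverse chart; `hzy` identifies the base point of each factor.
  rw [← mfderiv_eq_fderiv]
  have e1 : mfderiv 𝓘(ℝ, E) 𝓘(ℝ, E') (writtenInExtChartAt I I' x f) (extChartAt I x y) =
      (mfderiv I' 𝓘(ℝ, E') (extChartAt I' (f x)) (f y)).comp
        (mfderiv 𝓘(ℝ, E) I' (f ∘ (extChartAt I x).symm) (extChartAt I x y)) := by
    have hF : HasMFDerivAt I' 𝓘(ℝ, E') (extChartAt I' (f x))
        ((f ∘ (extChartAt I x).symm) (extChartAt I x y))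
        (mfderiv I' 𝓘(ℝ, E') (extChartAt I' (f x)) (f y) : E' →L[ℝ] E') := by
      rw [Function.comp_apply, hzy]
      exact hd3.hasMFDerivAt
    exact (hF.comp _ hd2.hasMFDerivAt).mfderiv
  have e2 : mfderiv 𝓘(ℝ, E) I' (f ∘ (extChartAt I x).symm) (extChartAt I x y) =
      (mfderiv I I' f y).comp (mfderiv 𝓘(ℝ, E) I (extChartAt I x).symm (extChartAt I x y)) := by
    have hF : HasMFDerivAt I I' f ((extChartAt I x).symm (extChartAt I x y))
        (mfderiv I I' f y : E →L[ℝ] E') := by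
      rw [hzy]
      exact (hfx y).hasMFDerivAt
    exact (hF.comp _ hd1.hasMFDerivAt).mfderiv
  rw [e1, e2]
  rfl

/-- The pullback of a torsion-free connection is torsion-free. -/
lemma covAlong_push_extend_comm [I.Boundaryless]
    {D' : CovariantDerivative I' E' (fun x : M' => TangentSpace I' x)} (hD' : D'.torsion = 0)
    (hf : ContMDiff I I' ∞ f) (v w : TangentSpace I x) :
    covAlong f D' (push f (FiberBundle.extend E v)) x w =
      covAlong f D' (push f (FiberBundle.extend E w)) x v := by
  let G := writtenInExtChartAt I I' x f
  have hG : ContDiffAt ℝ ∞ G (extChartAt I x x) := by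
    have h := (contMDiffAt_iff.1 (hf x)).2
    rw [I.range_eq_univ] at h
    exact h.contDiffAt Filter.univ_mem
  have hG' : DifferentiableAt ℝ (fderiv ℝ G) (extChartAt I x x) :=
    (hG.fderiv_right (m := 1) (by norm_cast)).differentiableAt (by simp)
  have hsymm := hG.isSymmSndFDerivAt (by simp; norm_cast)
  -- The chart at `x` has identity derivative there, so the coordinate term is the second derivative
  -- of `G`, symmetric by `hsymm`. The connection terms agree by `cov_extend_comm`.
  have key : ∀ v w : TangentSpace I x,
      mvfderiv I (coordAlong (I' := I') f (push f (FiberBundle.extend E w)) x) x v =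
        fderiv ℝ (fderiv ℝ G) (extChartAt I x x) v w := by
    intro v w
    rw [mvfderiv_congr (coordAlong_push_extend hf w)]
    have h1 : HasFDerivAt (fun z => fderiv ℝ G z w)
        ((fderiv ℝ (fderiv ℝ G) (extChartAt I x x)).flip w) (extChartAt I x x) :=
      hG'.hasFDerivAt.clm_apply (hasFDerivAt_const w _) |>.congr_fderiv
        (by ext; simp; exact ContinuousLinearMap.map_zero _)
    have h2 : HasMFDerivAt I 𝓘(ℝ, E) (extChartAt I x) x (ContinuousLinearMap.id ℝ E) := by
      have := (mdifferentiableAt_extChartAt (I := I) (mem_chart_source H x)).hasMFDerivAt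
      rwa [mfderiv_extChartAt_self] at this
    have h3 := (h1.hasMFDerivAt.comp x h2).mfderiv
    exact congrArg (fun L : E →L[ℝ] E' => L v) h3
  rw [covAlong_eq, covAlong_eq, key, key]
  have e1 : ∀ u : TangentSpace I x, push (I' := I') f (FiberBundle.extend E u) x =
      mfderiv I I' f x u := by intro u; simp [push]
  have e2 : fderiv ℝ (fderiv ℝ G) (extChartAt I x x) w v =
    fderiv ℝ (fderiv ℝ G) (extChartAt I x x) v w := hsymm.eq w v
  rw [e1, e1, cov_extend_comm hD', e2]

end Symmetry

/-! ### Differentiability tested by inner products. -/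

section Gram

variable {E : Type*} [NormedAddCommGroup E] [NormedSpace ℝ E] [FiniteDimensional ℝ E]
  {H : Type*} [TopologicalSpace H] {I : ModelWithCorners ℝ E H}
  {M : Type*} [TopologicalSpace M] [ChartedSpace H M] [IsManifold I ∞ M] {x : M}

lemma mdifferentiableAt_det {ι : Type} [Fintype ι] [DecidableEq ι] {A : M → Matrix ι ι ℝ}
    (hA : ∀ i j, MDifferentiableAt I 𝓘(ℝ, ℝ) (fun y => A y i j) x) :
    MDifferentiableAt I 𝓘(ℝ, ℝ) (fun y => (A y).det) x := by
  have h : (fun y => (A y).det) = ∑ σ : Equiv.Perm ι,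
      (fun _ : M => ((Equiv.Perm.sign σ : ℤ) : ℝ)) * ∏ i, fun y => A y (σ i) i := by
    ext y
    simp [Matrix.det_apply']
  rw [h]
  exact MDifferentiableAt.sum fun σ _ =>
    mdifferentiableAt_const.mul (MDifferentiableAt.prod fun i _ => hA _ _)

variable [RiemannianBundle (fun x : M => TangentSpace I x)]
  [IsContMDiffRiemannianBundle I ∞ E (fun x : M => TangentSpace I x)]

/-- A vector field is differentiable if its scalar products with differentiable vector fields
are. -/
lemma mdifferentiableAt_of_inner {Z : Π x : M, TangentSpace I x}
    (hZ : ∀ Y : Π x : M, TangentSpace I x, MDiffAt (T% Y) x →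
      MDifferentiableAt I 𝓘(ℝ, ℝ) (fun y => inner ℝ (Y y) (Z y)) x) : MDiffAt (T% Z) x := by
  classical
  let b := Module.finBasis ℝ E
  let e := trivializationAt E (TangentSpace I : M → Type _) x
  have hx : x ∈ e.baseSet := FiberBundle.mem_baseSet_trivializationAt' x
  have hs := e.isLocalFrameOn_localFrame_baseSet I 1 b
  have hsd : ∀ i, MDiffAt (T% (e.localFrame b i)) x := fun i =>
    (hs.contMDiffAt e.open_baseSet hx i).mdifferentiableAt one_ne_zero
  -- The frame coefficients of `Z` solve the linear system with Gram matrix `G` and right-hand side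
  -- `w`. By Cramer's rule they are quotients of determinants with differentiable entries.
  let G : M → Matrix _ _ ℝ := fun y => Matrix.gram ℝ fun i => e.localFrame b i y
  let w : M → _ → ℝ := fun y i => inner ℝ (e.localFrame b i y) (Z y)
  have hG : ∀ i j, MDifferentiableAt I 𝓘(ℝ, ℝ) (fun y => G y i j) x := fun i j =>
    MDifferentiableAt.inner_bundle (IB := I) (F := E) (E := fun x : M => TangentSpace I x)
      (hsd i) (hsd j)
  have hdet : ∀ y ∈ e.baseSet, (G y).det ≠ 0 := fun y hy =>
    Matrix.det_gram_ne_zero_iff_linearIndependent.2 (hs.linearIndependent hy)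
  refine hs.mdifferentiableAt_of_coeff (fun i => ?_) (e.open_baseSet.mem_nhds hx)
  have h1 : MDifferentiableAt I 𝓘(ℝ, ℝ) (fun y => ((G y).updateCol i (w y)).det) x := by
    refine mdifferentiableAt_det fun k j => ?_
    by_cases hji : j = i
    · subst hji
      simpa [w] using hZ _ (hsd k)
    · simpa [Matrix.updateCol_ne hji] using hG k j
  have h2 : MDifferentiableAt I 𝓘(ℝ, ℝ) (fun y => ((G y).det)⁻¹) x :=
    (mdifferentiableAt_det hG).inv (hdet x hx)
  refine (h2.mul h1).congr_of_eventuallyEq ?_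
  filter_upwards [e.open_baseSet.mem_nhds hx] with y hy
  have hw : w y = Matrix.mulVec (G y) fun j => hs.coeff j y (Z y) := by
    ext k
    have := hs.coeff_sum_eq Z hy
    simp only [w, Matrix.mulVec, dotProduct, G, Matrix.gram_apply]
    conv_lhs => rw [this, inner_sum]
    simp only [real_inner_smul_right]
    exact Finset.sum_congr rfl fun j _ => mul_comm _ _
  have h3 : ((G y).updateCol i (w y)).det = (G y).det * hs.coeff i y (Z y) := by
    rw [← Matrix.cramer_apply, Matrix.cramer_eq_adjugate_mulVec, hw, Matrix.mulVec_mulVec,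
      Matrix.adjugate_mul, Matrix.smul_mulVec, Matrix.one_mulVec]
    rfl
  simp only [LinearMap.piApply, Pi.mul_apply]
  rw [h3, inv_mul_cancel_left₀ (hdet y hy)]
  rfl

end Gram

/-! ### Tangential and normal parts, Gauss and Weingarten formulas. -/

section Decomposition

variable {E : Type*} [NormedAddCommGroup E] [NormedSpace ℝ E] [FiniteDimensional ℝ E]
  {H : Type*} [TopologicalSpace H] {I : ModelWithCorners ℝ E H}
  {M : Type*} [TopologicalSpace M] [ChartedSpace H M] [IsManifold I ∞ M]
  [RiemannianBundle (fun x : M => TangentSpace I x)]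
  {E' : Type*} [NormedAddCommGroup E'] [NormedSpace ℝ E'] [FiniteDimensional ℝ E']
  {H' : Type*} [TopologicalSpace H'] {I' : ModelWithCorners ℝ E' H'}
  {M' : Type*} [TopologicalSpace M'] [ChartedSpace H' M'] [IsManifold I' ∞ M']
  [RiemannianBundle (fun x : M' => TangentSpace I' x)]
  {f : M → M'} {x : M}

lemma mfderiv_tan (w : TangentSpace I' (f x)) :
    mfderiv I I' f x (tan I f x w) = (tangentSubspace I f x).starProjection w :=
  Function.invFun_eq (Submodule.starProjection_apply_mem (tangentSubspace I f x) w)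

lemma mfderiv_tan_add_nor (w : TangentSpace I' (f x)) :
    mfderiv I I' f x (tan I f x w) + nor I f x w = w := by
  rw [mfderiv_tan, nor]
  abel

lemma isNormalAt_nor (w : TangentSpace I' (f x)) : IsNormalAt I f x (nor I f x w) := by
  intro v
  have h : w - (tangentSubspace I f x).starProjection w ∈ (tangentSubspace I f x)ᗮ :=
    Submodule.sub_starProjection_mem_orthogonal w
  exact Submodule.inner_left_of_mem_orthogonal (LinearMap.mem_range_self _ v) h

lemma IsIsometricImmersion.injective (hf : IsIsometricImmersion I I' f) :
    Function.Injective (mfderiv I I' f x) := by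
  refine (injective_iff_map_eq_zero (mfderiv I I' f x)).2 fun v hv => ?_
  have h := hf.isometric x v v
  rw [hv, inner_zero_left] at h
  exact inner_self_eq_zero.1 h.symm

lemma inner_tan (hf : IsIsometricImmersion I I' f) (w : TangentSpace I' (f x))
    (u : TangentSpace I x) : inner ℝ (tan I f x w) u = inner ℝ w (mfderiv I I' f x u) := by
  conv_rhs => rw [← mfderiv_tan_add_nor (I := I) w]
  rw [inner_add_left, isNormalAt_nor w u, add_zero, hf.isometric]

/-- `tan` is defined by a choice of preimage; this characterization by inner products replaces the
choice in what follows. -/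
lemma tan_eq_of_inner (hf : IsIsometricImmersion I I' f) {w : TangentSpace I' (f x)}
    {a : TangentSpace I x} (h : ∀ u, inner ℝ w (mfderiv I I' f x u) = inner ℝ a u) :
    tan I f x w = a :=
  ext_inner_right ℝ fun u => by rw [inner_tan hf, h]

lemma tan_add (hf : IsIsometricImmersion I I' f) (w₁ w₂ : TangentSpace I' (f x)) :
    tan I f x (w₁ + w₂) = tan I f x w₁ + tan I f x w₂ :=
  tan_eq_of_inner hf fun u => by
    rw [inner_add_left, inner_add_left, inner_tan hf, inner_tan hf]

lemma tan_smul (hf : IsIsometricImmersion I I' f) (c : ℝ) (w : TangentSpace I' (f x)) :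
    tan I f x (c • w) = c • tan I f x w :=
  tan_eq_of_inner hf fun u => by rw [real_inner_smul_left, real_inner_smul_left, inner_tan hf]

variable (I) in
/-- The tangential part as a linear map. -/
noncomputable def tanₗ (hf : IsIsometricImmersion I I' f) (x : M) :
    TangentSpace I' (f x) →ₗ[ℝ] TangentSpace I x where
  toFun := tan I f x
  map_add' := tan_add hf
  map_smul' := tan_smul hf

variable (I) in
/-- The normal part as a linear map. -/
noncomputable def norₗ (f : M → M') (x : M) :
    TangentSpace I' (f x) →ₗ[ℝ] TangentSpace I' (f x) where
  toFun := nor I f x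
  map_add' w₁ w₂ := by simp only [nor, map_add]; abel
  map_smul' c w := by simp only [nor, map_smul, smul_sub, RingHom.id_apply]

lemma tan_mfderiv (hf : IsIsometricImmersion I I' f) (u : TangentSpace I x) :
    tan I f x (mfderiv I I' f x u) = u :=
  tan_eq_of_inner hf fun v => hf.isometric x u v

lemma nor_mfderiv (u : TangentSpace I x) : nor I f x (mfderiv I I' f x u) = 0 := by
  have h : (tangentSubspace I f x).starProjection (mfderiv I I' f x u) = mfderiv I I' f x u :=
    Submodule.starProjection_eq_self_iff.2 (LinearMap.mem_range_self _ u)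
  rw [nor, h, sub_self]

lemma IsNormalAt.tan_eq_zero (hf : IsIsometricImmersion I I' f) {w : TangentSpace I' (f x)}
    (h : IsNormalAt I f x w) : tan I f x w = 0 :=
  tan_eq_of_inner hf fun u => by rw [h u, inner_zero_left]

lemma IsNormalAt.nor_eq_self (hf : IsIsometricImmersion I I' f) {w : TangentSpace I' (f x)}
    (h : IsNormalAt I f x w) : nor I f x w = w := by
  have h1 := mfderiv_tan_add_nor (I := I) w
  rwa [h.tan_eq_zero hf, map_zero, zero_add] at h1

lemma inner_nor_left {w m : TangentSpace I' (f x)} (hm : IsNormalAt I f x m) :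
    inner ℝ (nor I f x w) m = inner ℝ w m := by
  conv_rhs => rw [← mfderiv_tan_add_nor (I := I) w]
  rw [inner_add_left, real_inner_comm m (mfderiv I I' f x _), hm, zero_add]

lemma MDiffAlongAt.push (hf : ContMDiff I I' ∞ f) {Y : Π x : M, TangentSpace I x}
    (hY : MDiffAt (T% Y) x) : MDiffAlongAt I f (push (I' := I') f Y) x := by
  have h1 : ContMDiff I.tangent I'.tangent 1 (tangentMap I I' f) :=
    hf.contMDiff_tangentMap (m := 1) (by norm_cast)
  exact MDifferentiableAt.comp x ((h1.mdifferentiable one_ne_zero) _) hY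

variable [IsContMDiffRiemannianBundle I ∞ E (fun x : M => TangentSpace I x)]
  [IsContMDiffRiemannianBundle I' ∞ E' (fun x : M' => TangentSpace I' x)]
  {W : Π x : M, TangentSpace I' (f x)}

/-- The pointwise choice in `tan` carries no regularity, but `g(W^T, Y) = g(W, df Y)` is
differentiable for every differentiable `Y`. -/
lemma MDiffAlongAt.tan (hf : IsIsometricImmersion I I' f) (hW : MDiffAlongAt I f W x) :
    MDiffAt (T% (fun y => tan I f y (W y))) x := by
  refine mdifferentiableAt_of_inner fun Y hY => ?_
  have h := hW.inner (MDiffAlongAt.push hf.smooth hY)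
  refine h.congr_of_eventuallyEq (Filter.Eventually.of_forall fun y => ?_)
  simp only
  rw [real_inner_comm, inner_tan hf]
  rfl

lemma MDiffAlongAt.nor (hf : IsIsometricImmersion I I' f) (hW : MDiffAlongAt I f W x) :
    MDiffAlongAt I f (fun y => nor I f y (W y)) x :=
  (hW.sub (.push hf.smooth (hW.tan hf))).congr (Filter.Eventually.of_forall fun y =>
    eq_sub_of_add_eq' (mfderiv_tan_add_nor (I := I) (W y)))

variable {D' : CovariantDerivative I' E' (fun x : M' => TangentSpace I' x)}
  {D : CovariantDerivative I E (fun x : M => TangentSpace I x)}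

/-- The Gauss formula: the tangential part of the pullback connection is the Levi-Civita
connection of the submanifold. -/
lemma tan_covAlong_push [I.Boundaryless] (hD : IsLeviCivita D) (hD' : IsLeviCivita D')
    (hf : IsIsometricImmersion I I' f) {Y : Π x : M, TangentSpace I x} (hY : MDiffAt (T% Y) x)
    (v : TangentSpace I x) : tan I f x (covAlong f D' (push f Y) x v) = D Y x v := by
  have hext : ∀ w : TangentSpace I x, MDiffAt (T% (FiberBundle.extend E w)) x :=
    fun w => FiberBundle.mdifferentiableAt_extend I E w
  -- `S` measures the failure of the Gauss formula, tested against `u`.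
  let S : (Π x : M, TangentSpace I x) → TangentSpace I x → TangentSpace I x → ℝ :=
    fun Y v u => inner ℝ (covAlong f D' (push f Y) x v) (mfderiv I I' f x u) - inner ℝ (D Y x v) u
  -- Both connections are metric and `f` is isometric, so the derivatives of `g(df Y, df Z)` and
  -- `g(Y, Z)` coincide.
  have skew : ∀ Y Z : Π x : M, TangentSpace I x, MDiffAt (T% Y) x → MDiffAt (T% Z) x →
      ∀ v, S Y v (Z x) = - S Z v (Y x) := by
    intro Y Z hY hZ v
    have h1 := mvfderiv_inner_along hD' (MDiffAlongAt.push hf.smooth hY)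
      (MDiffAlongAt.push hf.smooth hZ) v
    have h2 := hD.metric x Y Z hY hZ v
    have h3 : (fun y => inner ℝ (push (I' := I') f Y y) (push f Z y)) =
        fun y => inner ℝ (Y y) (Z y) := by
      ext y
      exact hf.isometric y _ _
    rw [h3, h2] at h1
    simp only [push] at h1
    have h4 := real_inner_comm (covAlong f D' (push f Z) x v) (mfderiv I I' f x (Y x))
    have h5 := real_inner_comm (D Z x v) (Y x)
    simp only [S]
    linarith
  -- Skewness moves `Y` to the slot where only its value at `x` enters.
  have tens : ∀ Y : Π x : M, TangentSpace I x, MDiffAt (T% Y) x → ∀ v u,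
      S Y v u = S (FiberBundle.extend E (Y x)) v u := by
    intro Y hY v u
    have h1 := skew Y _ hY (hext u) v
    have h2 := skew _ _ (hext (Y x)) (hext u) v
    simp only [FiberBundle.extend_apply_self] at h1 h2
    rw [h1, h2]
  have symm : ∀ a b u : TangentSpace I x,
      S (FiberBundle.extend E a) b u = S (FiberBundle.extend E b) a u := by
    intro a b u
    simp only [S]
    rw [covAlong_push_extend_comm hD'.torsion_free hf.smooth,
      cov_extend_comm hD.torsion_free]
  have skew' : ∀ a b u : TangentSpace I x,
      S (FiberBundle.extend E a) b u = - S (FiberBundle.extend E u) b a := by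
    intro a b u
    have h := skew _ _ (hext a) (hext u) b
    simpa only [FiberBundle.extend_apply_self] using h
  refine tan_eq_of_inner hf fun u => sub_eq_zero.1 ?_
  change S Y v u = 0
  rw [tens Y hY]
  generalize Y x = a
  -- A form symmetric in two slots and skew in another pair vanishes: alternating the two relations
  -- returns to the start after three sign changes.
  have e1 := skew' a v u
  have e2 := symm u v a
  have e3 := skew' v u a
  have e4 := symm a u v
  have e5 := skew' u a v
  have e6 := symm v a u
  linarith

/-- The Weingarten formula. -/
lemma inner_covAlong_mfderiv (hD' : IsLeviCivita D')
    (hf : IsIsometricImmersion I I' f) {ξ : Π x : M, TangentSpace I' (f x)}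
    (hξ : MDiffAlongAt I f ξ x) (hn : ∀ᶠ y in 𝓝 x, IsNormalAt I f y (ξ y))
    {Y : Π x : M, TangentSpace I x} (hY : MDiffAt (T% Y) x) (v : TangentSpace I x) :
    inner ℝ (covAlong f D' ξ x v) (mfderiv I I' f x (Y x)) = - hTensor f D' ξ x v Y := by
  have h := mvfderiv_inner_along hD' hξ (MDiffAlongAt.push hf.smooth hY) v
  -- The function `g(ξ, df Y)` vanishes near `x`, so its derivative is zero.
  rw [mvfderiv_congr (g₂ := fun _ => (0 : ℝ)) (by
    filter_upwards [hn] with y hy using hy (Y y)), mvfderiv_const, zero_apply] at h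
  rw [hTensor, secondFundamentalForm, inner_nor_left hn.self_of_nhds, real_inner_comm (ξ x)]
  simp only [MetallicSubmanifold.push] at h
  linarith

/-- The Weingarten formula supplies the vector required by the definition, so the default value `0`
is not taken; testing against extensions of tangent vectors gives uniqueness. -/
lemma shapeOperator_eq (hD' : IsLeviCivita D')
    (hf : IsIsometricImmersion I I' f) {ξ : Π x : M, TangentSpace I' (f x)}
    (hξ : MDiffAlongAt I f ξ x) (hn : ∀ᶠ y in 𝓝 x, IsNormalAt I f y (ξ y))
    (v : TangentSpace I x) :
    shapeOperator f D' ξ x v = - MetallicSubmanifold.tan I f x (covAlong f D' ξ x v) := by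
  have hex : ∃ a : TangentSpace I x, ∀ Y : Π x : M, TangentSpace I x, MDiffAt (T% Y) x →
      inner ℝ a (Y x) = hTensor f D' ξ x v Y := by
    refine ⟨- MetallicSubmanifold.tan I f x (covAlong f D' ξ x v), fun Y hY => ?_⟩
    rw [inner_neg_left, inner_tan hf, inner_covAlong_mfderiv hD' hf hξ hn hY, neg_neg]
  rw [shapeOperator, dif_pos hex]
  refine ext_inner_right ℝ fun u => ?_
  have hu : MDiffAt (T% (FiberBundle.extend E u)) x := FiberBundle.mdifferentiableAt_extend I E u
  have h1 := hex.choose_spec _ hu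
  have h2 := inner_covAlong_mfderiv hD' hf hξ hn hu v
  rw [FiberBundle.extend_apply_self] at h1 h2
  rw [h1, inner_neg_left, inner_tan hf, h2, neg_neg]

end Decomposition

/-! ### Orthonormal normal frames and the structure equations. -/

section Frame

variable {E : Type*} [NormedAddCommGroup E] [NormedSpace ℝ E] [FiniteDimensional ℝ E]
  {H : Type*} [TopologicalSpace H] {I : ModelWithCorners ℝ E H}
  {M : Type*} [TopologicalSpace M] [ChartedSpace H M] [IsManifold I ∞ M]
  [RiemannianBundle (fun x : M => TangentSpace I x)]
  {E' : Type*} [NormedAddCommGroup E'] [NormedSpace ℝ E'] [FiniteDimensional ℝ E']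
  {H' : Type*} [TopologicalSpace H'] {I' : ModelWithCorners ℝ E' H'}
  {M' : Type*} [TopologicalSpace M'] [ChartedSpace H' M'] [IsManifold I' ∞ M']
  [RiemannianBundle (fun x : M' => TangentSpace I' x)]
  {f : M → M'} {x : M} {O : Set M} {r : ℕ}
  {ν : Fin r → Π x : M, TangentSpace I' (f x)}

/-- An orthonormal normal frame of the right cardinality spans the normal space. -/
lemma IsNormalAt.eq_sum (hr : Module.finrank ℝ E' = Module.finrank ℝ E + r)
    (hf : IsIsometricImmersion I I' f) (hν : IsOrthonormalNormalFrameOn I f O ν) (hx : x ∈ O)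
    {m : TangentSpace I' (f x)} (hm : IsNormalAt I f x m) :
    m = ∑ α, inner ℝ m (ν α x) • ν α x := by
  have : FiniteDimensional ℝ (TangentSpace I x) := inferInstanceAs (FiniteDimensional ℝ E)
  have : FiniteDimensional ℝ (TangentSpace I' (f x)) := inferInstanceAs (FiniteDimensional ℝ E')
  have hon := hν.orthonormal x hx
  have mem : ∀ w : TangentSpace I' (f x), IsNormalAt I f x w →
      w ∈ (tangentSubspace I (I' := I') f x)ᗮ := by
    intro w hw
    rw [Submodule.mem_orthogonal']
    rintro _ ⟨v, rfl⟩
    exact hw v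
  have hle : Submodule.span ℝ (range fun α => ν α x) ≤ (tangentSubspace I (I' := I') f x)ᗮ := by
    rw [Submodule.span_le]
    rintro _ ⟨α, rfl⟩
    exact mem _ (hν.normal α x hx)
  have h1 : Module.finrank ℝ (tangentSubspace I (I' := I') f x) = Module.finrank ℝ E :=
    LinearMap.finrank_range_of_inj (f := (mfderiv I I' f x).toLinearMap) hf.injective
  have h2 := Submodule.finrank_add_finrank_orthogonal (tangentSubspace I (I' := I') f x)
  have h3 : Module.finrank ℝ (Submodule.span ℝ (range fun α => ν α x)) = r := by
    rw [finrank_span_eq_card hon.linearIndependent, Fintype.card_fin]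
  have h4 : Module.finrank ℝ (TangentSpace I' (f x)) = Module.finrank ℝ E' := rfl
  -- The `r` orthonormal normals span a subspace of the normal space, whose dimension is also `r`.
  have heq := Submodule.eq_of_le_of_finrank_eq hle (by omega)
  have hm' := mem m hm
  rw [← heq] at hm'
  obtain ⟨c, rfl⟩ := (Submodule.mem_span_range_iff_exists_fun ℝ).1 hm'
  refine Finset.sum_congr rfl fun α _ => ?_
  rw [real_inner_comm, hon.inner_right_fintype]

lemma IsOrthonormalNormalFrameOn.mdiffAlongAt (hO : IsOpen O)
    (hν : IsOrthonormalNormalFrameOn I f O ν) (hx : x ∈ O) (α : Fin r) :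
    MDiffAlongAt I f (ν α) x :=
  ((hν.smooth α).contMDiffAt (hO.mem_nhds hx)).mdifferentiableAt (by simp)

lemma IsOrthonormalNormalFrameOn.eventually_isNormalAt (hO : IsOpen O)
    (hν : IsOrthonormalNormalFrameOn I f O ν) (hx : x ∈ O) (α : Fin r) :
    ∀ᶠ y in 𝓝 x, IsNormalAt I f y (ν α y) := by
  filter_upwards [hO.mem_nhds hx] with y hy using hν.normal α y hy

variable [IsContMDiffRiemannianBundle I ∞ E (fun x : M => TangentSpace I x)]
  [IsContMDiffRiemannianBundle I' ∞ E' (fun x : M' => TangentSpace I' x)]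
  {D' : CovariantDerivative I' E' (fun x : M' => TangentSpace I' x)}
  {D : CovariantDerivative I E (fun x : M => TangentSpace I x)}

lemma covAlong_push_eq [I.Boundaryless] (hr : Module.finrank ℝ E' = Module.finrank ℝ E + r)
    (hD : IsLeviCivita D) (hD' : IsLeviCivita D') (hf : IsIsometricImmersion I I' f)
    (hν : IsOrthonormalNormalFrameOn I f O ν) (hx : x ∈ O) {Y : Π x : M, TangentSpace I x}
    (hY : MDiffAt (T% Y) x) (v : TangentSpace I x) :
    covAlong f D' (push f Y) x v =
      mfderiv I I' f x (D Y x v) + ∑ α, hTensor f D' (ν α) x v Y • ν α x := by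
  conv_lhs => rw [← mfderiv_tan_add_nor (I := I) (covAlong f D' (push f Y) x v),
    tan_covAlong_push hD hD' hf hY, (isNormalAt_nor _).eq_sum hr hf hν hx]
  rfl

lemma covAlong_frame_eq (hD' : IsLeviCivita D') (hf : IsIsometricImmersion I I' f)
    (hO : IsOpen O) (hν : IsOrthonormalNormalFrameOn I f O ν) (hx : x ∈ O) (α : Fin r)
    (v : TangentSpace I x) :
    covAlong f D' (ν α) x v =
      normalCov f D' (ν α) x v - mfderiv I I' f x (shapeOperator f D' (ν α) x v) := by
  rw [shapeOperator_eq hD' hf (hν.mdiffAlongAt hO hx α) (hν.eventually_isNormalAt hO hx α),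
    map_neg, sub_neg_eq_add, add_comm]
  exact (mfderiv_tan_add_nor (I := I) _).symm

/-- The derivative of a normal field in terms of its coefficients in an orthonormal frame. -/
lemma covAlong_normal_eq (hr : Module.finrank ℝ E' = Module.finrank ℝ E + r)
    (hD' : IsLeviCivita D') (hf : IsIsometricImmersion I I' f)
    (hO : IsOpen O) (hν : IsOrthonormalNormalFrameOn I f O ν) (hx : x ∈ O)
    {U : Π x : M, TangentSpace I' (f x)} (hU : MDiffAlongAt I f U x)
    (hn : ∀ y ∈ O, IsNormalAt I f y (U y)) (v : TangentSpace I x) :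
    covAlong f D' U x v =
      ∑ α, (mvfderiv I (fun y => inner ℝ (U y) (ν α y)) x v • ν α x +
        inner ℝ (U x) (ν α x) •
          (normalCov f D' (ν α) x v - mfderiv I I' f x (shapeOperator f D' (ν α) x v))) := by
  have hνd := hν.mdiffAlongAt hO hx
  -- The frame expansion holds on the open set `O`, which suffices since the derivative is local.
  have hU' : ∀ᶠ y in 𝓝 x, U y = ∑ α, inner ℝ (U y) (ν α y) • ν α y := by
    filter_upwards [hO.mem_nhds hx] with y hy using (hn y hy).eq_sum hr hf hν hy
  rw [covAlong_congr D' hU', covAlong_sum D' _ (mdiffAlongAt_iff.1 hU).1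
    fun α _ => (hνd α).smul (hU.inner (hνd α))]
  refine Finset.sum_congr rfl fun α _ => ?_
  rw [covAlong_smul D' (hU.inner (hνd α)) (hνd α), covAlong_frame_eq hD' hf hO hν hx]

lemma normalCov_frame_eq (hr : Module.finrank ℝ E' = Module.finrank ℝ E + r)
    (hf : IsIsometricImmersion I I' f) (hν : IsOrthonormalNormalFrameOn I f O ν) (hx : x ∈ O)
    (α : Fin r) (v : TangentSpace I x) :
    normalCov f D' (ν α) x v = ∑ β, normalForm f D' ν α β x v • ν β x :=
  (isNormalAt_nor _).eq_sum hr hf hν hx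

/-- Expanding `∇^⊥ ν_α` in the frame and exchanging the double sum collects the coefficient of each
`ν_α`; this is why the form appears as `λ_{βα}`. -/
lemma covAlong_normal_eq' (hr : Module.finrank ℝ E' = Module.finrank ℝ E + r)
    (hD' : IsLeviCivita D') (hf : IsIsometricImmersion I I' f)
    (hO : IsOpen O) (hν : IsOrthonormalNormalFrameOn I f O ν) (hx : x ∈ O)
    {U : Π x : M, TangentSpace I' (f x)} (hU : MDiffAlongAt I f U x)
    (hn : ∀ y ∈ O, IsNormalAt I f y (U y)) (v : TangentSpace I x) :
    covAlong f D' U x v =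
      ∑ α, (mvfderiv I (fun y => inner ℝ (U y) (ν α y)) x v +
        ∑ β, inner ℝ (U x) (ν β x) * normalForm f D' ν β α x v) • ν α x -
      ∑ α, inner ℝ (U x) (ν α x) • mfderiv I I' f x (shapeOperator f D' (ν α) x v) := by
  rw [covAlong_normal_eq hr hD' hf hO hν hx hU hn]
  simp only [smul_sub, add_smul, Finset.sum_add_distrib, Finset.sum_sub_distrib,
    normalCov_frame_eq hr hf hν hx, Finset.smul_sum, Finset.sum_smul, smul_smul]
  rw [Finset.sum_comm (f := fun α β =>
    (inner ℝ (U x) (ν α x) * normalForm f D' ν α β x v) • ν β x)]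
  abel

variable {J : Π x : M', TangentSpace I' x →L[ℝ] TangentSpace I' x} {p q : ℕ}

/-- The source of all four identities: `J` passes through the derivative, then `J W` splits into
tangential and normal fields, both differentiable. -/
lemma covAlong_apply_eq_add (hJ : IsLocallyMetallic p q J D') (hf : IsIsometricImmersion I I' f)
    {W : Π x : M, TangentSpace I' (f x)} (hW : MDiffAlongAt I f W x) (v : TangentSpace I x) :
    J (f x) (covAlong f D' W x v) =
      covAlong f D' (push f fun y => tan I f y (J (f y) (W y))) x v +
        covAlong f D' (fun y => nor I f y (J (f y) (W y))) x v := by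
  have hJW := hW.apply_metallic hJ.metallic
  rw [← covAlong_apply_metallic hJ hW, ← covAlong_add D' (.push hf.smooth (hJW.tan hf)) (hJW.nor hf)]
  exact covAlong_congr D' (Filter.Eventually.of_forall fun y =>
    (mfderiv_tan_add_nor (I := I) (J (f y) (W y))).symm) v

/-- The tangential part of `J (∇̄_v W) = ∇̄_v (J W)`. -/
lemma tan_apply_covAlong [I.Boundaryless] (hr : Module.finrank ℝ E' = Module.finrank ℝ E + r)
    (hJ : IsLocallyMetallic p q J D') (hD : IsLeviCivita D) (hf : IsIsometricImmersion I I' f)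
    (hO : IsOpen O) (hν : IsOrthonormalNormalFrameOn I f O ν) (hx : x ∈ O)
    {W : Π x : M, TangentSpace I' (f x)} (hW : MDiffAlongAt I f W x) (v : TangentSpace I x) :
    tan I f x (J (f x) (covAlong f D' W x v)) =
      D (fun y => tan I f y (J (f y) (W y))) x v -
        ∑ α, inner ℝ (nor I f x (J (f x) (W x))) (ν α x) • shapeOperator f D' (ν α) x v := by
  have hD' := hJ.leviCivita
  have hJW := hW.apply_metallic hJ.metallic
  rw [covAlong_apply_eq_add hJ hf hW, tan_add hf, tan_covAlong_push hD hD' hf (hJW.tan hf),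
    covAlong_normal_eq hr hD' hf hO hν hx (hJW.nor hf) fun y _ => isNormalAt_nor _, sub_eq_add_neg]
  congr 1
  -- Of the derivative of the normal field `(J W)^⊥`, only the shape operator terms are tangential.
  have t1 : ∀ u, tanₗ I hf x (mfderiv I I' f x u) = u := tan_mfderiv hf
  have t2 : ∀ α, tanₗ I hf x (ν α x) = 0 := fun α => (hν.normal α x hx).tan_eq_zero hf
  have t3 : ∀ α, tanₗ I hf x (normalCov f D' (ν α) x v) = 0 :=
    fun α => (isNormalAt_nor _).tan_eq_zero hf
  change tanₗ I hf x _ = _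
  simp only [map_add, map_sum, map_smul, map_sub, t1, t2, t3, smul_zero, zero_add, zero_sub,
    smul_neg, Finset.sum_neg_distrib]

/-- The normal part of `J (∇̄_v W) = ∇̄_v (J W)`. -/
lemma nor_apply_covAlong [I.Boundaryless] (hr : Module.finrank ℝ E' = Module.finrank ℝ E + r)
    (hJ : IsLocallyMetallic p q J D') (hD : IsLeviCivita D) (hf : IsIsometricImmersion I I' f)
    (hO : IsOpen O) (hν : IsOrthonormalNormalFrameOn I f O ν) (hx : x ∈ O)
    {W : Π x : M, TangentSpace I' (f x)} (hW : MDiffAlongAt I f W x) (v : TangentSpace I x) :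
    nor I f x (J (f x) (covAlong f D' W x v)) =
      ∑ α, hTensor f D' (ν α) x v (fun y => tan I f y (J (f y) (W y))) • ν α x +
        (∑ α, mvfderiv I (fun y => inner ℝ (nor I f y (J (f y) (W y))) (ν α y)) x v • ν α x +
          ∑ α, inner ℝ (nor I f x (J (f x) (W x))) (ν α x) • normalCov f D' (ν α) x v) := by
  have hD' := hJ.leviCivita
  have hJW := hW.apply_metallic hJ.metallic
  rw [covAlong_apply_eq_add hJ hf hW, covAlong_push_eq hr hD hD' hf hν hx (hJW.tan hf),
    covAlong_normal_eq hr hD' hf hO hν hx (hJW.nor hf) fun y _ => isNormalAt_nor _]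
  have n1 : ∀ u, norₗ I f x (mfderiv I I' f x u) = 0 := nor_mfderiv
  have n2 : ∀ α, norₗ I f x (ν α x) = ν α x := fun α => (hν.normal α x hx).nor_eq_self hf
  have n3 : ∀ α, norₗ I f x (normalCov f D' (ν α) x v) = normalCov f D' (ν α) x v :=
    fun α => (isNormalAt_nor _).nor_eq_self hf
  change norₗ I f x _ = _
  simp only [map_add, map_sum, map_smul, map_sub, n1, n2, n3, zero_add, sub_zero,
    Finset.sum_add_distrib]

/-- The case `W = df Y`, with `∇̄_v W` expanded by the Gauss formula before `J` is applied. -/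
theorem metallic_tangent_identities [I.Boundaryless]
    (hr : Module.finrank ℝ E' = Module.finrank ℝ E + r) (hJ : IsLocallyMetallic p q J D')
    (hD : IsLeviCivita D) (hf : IsIsometricImmersion I I' f)
    (hO : IsOpen O) (hν : IsOrthonormalNormalFrameOn I f O ν) (hx : x ∈ O)
    {Y : Π x : M, TangentSpace I x} (hY : MDiffAt (T% Y) x) (v : TangentSpace I x) :
    covEnd D (opT f J) Y x v =
        ∑ α, inner ℝ (opN f J x (Y x)) (ν α x) • shapeOperator f D' (ν α) x v
        + ∑ α, hTensor f D' (ν α) x v Y • opt I f J x (ν α x) ∧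
      ∑ α, inner ℝ (opN f J x (Y x)) (ν α x) • normalCov f D' (ν α) x v =
        opN f J x (D Y x v)
        + ∑ α, hTensor f D' (ν α) x v Y • opn I f J x (ν α x)
        - ∑ α, hTensor f D' (ν α) x v (fun y => opT f J y (Y y)) • ν α x
        - ∑ α, mvfderiv I (fun y => inner ℝ (opN f J y (Y y)) (ν α y)) x v • ν α x := by
  have hpY := MDiffAlongAt.push (I' := I') hf.smooth hY
  have ht := tan_apply_covAlong hr hJ hD hf hO hν hx hpY v
  have hn := nor_apply_covAlong hr hJ hD hf hO hν hx hpY v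
  rw [covAlong_push_eq hr hD hJ.leviCivita hf hν hx hY] at ht hn
  have ht' : tan I f x (J (f x) (mfderiv I I' f x (D Y x v) +
      ∑ α, hTensor f D' (ν α) x v Y • ν α x)) =
      opT f J x (D Y x v) + ∑ α, hTensor f D' (ν α) x v Y • opt I f J x (ν α x) := by
    change tanₗ I hf x _ = _
    simp only [map_add, map_sum, map_smul]
    rfl
  have hn' : nor I f x (J (f x) (mfderiv I I' f x (D Y x v) +
      ∑ α, hTensor f D' (ν α) x v Y • ν α x)) =
      opN f J x (D Y x v) + ∑ α, hTensor f D' (ν α) x v Y • opn I f J x (ν α x) := by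
    change norₗ I f x _ = _
    simp only [map_add, map_sum, map_smul]
    rfl
  rw [ht'] at ht
  rw [hn'] at hn
  constructor
  · have h2 := eq_sub_iff_add_eq.1 ht
    rw [covEnd, sub_eq_iff_eq_add]
    refine h2.symm.trans ?_
    simp only [opN, push]
    abel
  · rw [hn]
    simp only [opT, opN, push]
    abel

/-- The case `W = U`, with `∇̄_v U` expanded by `covAlong_normal_eq'` before `J` is applied. -/
theorem metallic_normal_identities [I.Boundaryless]
    (hr : Module.finrank ℝ E' = Module.finrank ℝ E + r) (hJ : IsLocallyMetallic p q J D')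
    (hD : IsLeviCivita D) (hf : IsIsometricImmersion I I' f)
    (hO : IsOpen O) (hν : IsOrthonormalNormalFrameOn I f O ν) (hx : x ∈ O)
    {U : Π x : M, TangentSpace I' (f x)} (hU : MDiffAlongAt I f U x)
    (hUn : ∀ y ∈ O, IsNormalAt I f y (U y)) (v : TangentSpace I x) :
    D (fun y => opt I f J y (U y)) x v =
        ∑ α, (inner ℝ (opn I f J x (U x)) (ν α x) • shapeOperator f D' (ν α) x v
          - inner ℝ (U x) (ν α x) • opT f J x (shapeOperator f D' (ν α) x v))
        + ∑ α, (mvfderiv I (fun y => inner ℝ (U y) (ν α y)) x v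
            + ∑ β, inner ℝ (U x) (ν β x) * normalForm f D' ν β α x v) •
          opt I f J x (ν α x) ∧
      ∑ α, inner ℝ (opn I f J x (U x)) (ν α x) • normalCov f D' (ν α) x v =
        - ∑ α, (mvfderiv I (fun y => inner ℝ (opn I f J y (U y)) (ν α y)) x v
            + hTensor f D' (ν α) x v (fun y => opt I f J y (U y))) • ν α x
        + ∑ α, (mvfderiv I (fun y => inner ℝ (U y) (ν α y)) x v
            + ∑ β, inner ℝ (U x) (ν β x) * normalForm f D' ν β α x v) •
          opn I f J x (ν α x)
        - ∑ α, inner ℝ (U x) (ν α x) • opN f J x (shapeOperator f D' (ν α) x v) := by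
  have ht := tan_apply_covAlong hr hJ hD hf hO hν hx hU v
  have hn := nor_apply_covAlong hr hJ hD hf hO hν hx hU v
  rw [covAlong_normal_eq' hr hJ.leviCivita hf hO hν hx hU hUn] at ht hn
  have ht' : ∀ (c u : Fin r → ℝ) (A : Fin r → TangentSpace I x),
      tan I f x (J (f x) (∑ α, c α • ν α x - ∑ α, u α • mfderiv I I' f x (A α))) =
        ∑ α, c α • opt I f J x (ν α x) - ∑ α, u α • opT f J x (A α) := by
    intro c u A
    change tanₗ I hf x _ = _
    simp only [map_sub, map_sum, map_smul]
    rfl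
  have hn' : ∀ (c u : Fin r → ℝ) (A : Fin r → TangentSpace I x),
      nor I f x (J (f x) (∑ α, c α • ν α x - ∑ α, u α • mfderiv I I' f x (A α))) =
        ∑ α, c α • opn I f J x (ν α x) - ∑ α, u α • opN f J x (A α) := by
    intro c u A
    change norₗ I f x _ = _
    simp only [map_sub, map_sum, map_smul]
    rfl
  rw [ht'] at ht
  -- Isolates the sum `∑ g(nU, ν_α) ∇^⊥ ν_α`.
  rw [hn', ← sub_eq_iff_eq_add', ← sub_eq_iff_eq_add'] at hn
  constructor
  · refine (eq_sub_iff_add_eq.1 ht).symm.trans ?_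
    simp only [opn, Finset.sum_sub_distrib]
    abel
  · refine hn.symm.trans ?_
    simp only [opt, opn, add_smul, Finset.sum_add_distrib]
    abel

end Frame

end MetallicSubmanifold

open MetallicSubmanifold in
theorem mainTheorem4 {n r p q : ℕ}
    -- the ambient Riemannian manifold `M'` of dimension `n + r`
    {M' : Type*} [TopologicalSpace M'] [ChartedSpace (EuclideanSpace ℝ (Fin (n + r))) M']
    [IsManifold (𝓡 (n + r)) ∞ M']
    [RiemannianBundle (fun x : M' => TangentSpace (𝓡 (n + r)) x)]
    [IsContMDiffRiemannianBundle (𝓡 (n + r)) ∞ (EuclideanSpace ℝ (Fin (n + r)))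
      (fun x : M' => TangentSpace (𝓡 (n + r)) x)]
    -- the Riemannian manifold `M` of dimension `n`
    {M : Type*} [TopologicalSpace M] [ChartedSpace (EuclideanSpace ℝ (Fin n)) M]
    [IsManifold (𝓡 n) ∞ M]
    [RiemannianBundle (fun x : M => TangentSpace (𝓡 n) x)]
    [IsContMDiffRiemannianBundle (𝓡 n) ∞ (EuclideanSpace ℝ (Fin n))
      (fun x : M => TangentSpace (𝓡 n) x)]
    -- the locally metallic structure of `M'`, with the Levi-Civita connection `D'` of `M'`
    (J : Π x : M', TangentSpace (𝓡 (n + r)) x →L[ℝ] TangentSpace (𝓡 (n + r)) x)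
    (D' : CovariantDerivative (𝓡 (n + r)) (EuclideanSpace ℝ (Fin (n + r)))
      (fun x : M' => TangentSpace (𝓡 (n + r)) x))
    (hJ : IsLocallyMetallic p q J D')
    -- the Levi-Civita connection `D` of `M`
    (D : CovariantDerivative (𝓡 n) (EuclideanSpace ℝ (Fin n))
      (fun x : M => TangentSpace (𝓡 n) x))
    (hD : IsLeviCivita D)
    -- the isometric immersion, and an orthonormal frame `ν` of the normal bundle over `O`
    (f : M → M') (hf : IsIsometricImmersion (𝓡 n) (𝓡 (n + r)) f)
    (O : Set M) (hO : IsOpen O)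
    (ν : Fin r → Π x : M, TangentSpace (𝓡 (n + r)) (f x))
    (hν : IsOrthonormalNormalFrameOn (𝓡 n) f O ν) :
    -- (1) for tangent vector fields `X`, `Y`
    (∀ X Y : Π x : M, TangentSpace (𝓡 n) x,
      ContMDiffOn (𝓡 n) (𝓡 n).tangent ∞ (fun x => (⟨x, X x⟩ : TangentBundle (𝓡 n) M)) O →
      ContMDiffOn (𝓡 n) (𝓡 n).tangent ∞ (fun x => (⟨x, Y x⟩ : TangentBundle (𝓡 n) M)) O →
      ∀ x ∈ O,
        -- (a)
        covEnd D (opT f J) Y x (X x) =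
          ∑ α, inner ℝ (opN f J x (Y x)) (ν α x) • shapeOperator f D' (ν α) x (X x)
          + ∑ α, hTensor f D' (ν α) x (X x) Y • opt (𝓡 n) f J x (ν α x) ∧
        -- (b)
        ∑ α, inner ℝ (opN f J x (Y x)) (ν α x) • normalCov f D' (ν α) x (X x) =
          opN f J x (D Y x (X x))
          + ∑ α, hTensor f D' (ν α) x (X x) Y • opn (𝓡 n) f J x (ν α x)
          - ∑ α, hTensor f D' (ν α) x (X x) (fun y => opT f J y (Y y)) • ν α x
          - ∑ α, mvfderiv (𝓡 n) (fun y => inner ℝ (opN f J y (Y y)) (ν α y)) x (X x) • ν α x) ∧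
    -- (2) for a tangent vector field `X` and a normal vector field `U`
    (∀ (X : Π x : M, TangentSpace (𝓡 n) x) (U : Π x : M, TangentSpace (𝓡 (n + r)) (f x)),
      ContMDiffOn (𝓡 n) (𝓡 n).tangent ∞ (fun x => (⟨x, X x⟩ : TangentBundle (𝓡 n) M)) O →
      SmoothAlongOn (𝓡 n) f O U → (∀ x ∈ O, IsNormalAt (𝓡 n) f x (U x)) →
      ∀ x ∈ O,
        -- (a)
        D (fun y => opt (𝓡 n) f J y (U y)) x (X x) =
          ∑ α, (inner ℝ (opn (𝓡 n) f J x (U x)) (ν α x) • shapeOperator f D' (ν α) x (X x)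
            - inner ℝ (U x) (ν α x) • opT f J x (shapeOperator f D' (ν α) x (X x)))
          + ∑ α, (mvfderiv (𝓡 n) (fun y => inner ℝ (U y) (ν α y)) x (X x)
              + ∑ β, inner ℝ (U x) (ν β x) * normalForm f D' ν β α x (X x)) •
            opt (𝓡 n) f J x (ν α x) ∧
        -- (b)
        ∑ α, inner ℝ (opn (𝓡 n) f J x (U x)) (ν α x) • normalCov f D' (ν α) x (X x) =
          - ∑ α, (mvfderiv (𝓡 n) (fun y => inner ℝ (opn (𝓡 n) f J y (U y)) (ν α y)) x (X x)
              + hTensor f D' (ν α) x (X x) (fun y => opt (𝓡 n) f J y (U y))) • ν α x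
          + ∑ α, (mvfderiv (𝓡 n) (fun y => inner ℝ (U y) (ν α y)) x (X x)
              + ∑ β, inner ℝ (U x) (ν β x) * normalForm f D' ν β α x (X x)) •
            opn (𝓡 n) f J x (ν α x)
          - ∑ α, inner ℝ (U x) (ν α x) • opN f J x (shapeOperator f D' (ν α) x (X x))) := by
  have hr : Module.finrank ℝ (EuclideanSpace ℝ (Fin (n + r))) =
      Module.finrank ℝ (EuclideanSpace ℝ (Fin n)) + r := by simp
  refine ⟨fun X Y _ hY x hx => ?_, fun X U _ hU hUn x hx => ?_⟩
  · exact metallic_tangent_identities hr hJ hD hf hO hν hx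
      ((hY.contMDiffAt (hO.mem_nhds hx)).mdifferentiableAt (by simp)) (X x)
  · exact metallic_normal_identities hr hJ hD hf hO hν hx
      ((ContMDiffOn.contMDiffAt hU (hO.mem_nhds hx)).mdifferentiableAt (by simp)) hUn (X x)
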